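/- **Setting.** Let $l>0$ and let $\rho,I_w,EI,GJ,\eta_\omega,\eta_\phi,\alpha_\omega,\beta_\omega,\gamma_\omega,\alpha_\phi,\beta_\phi,\gamma_\phi\in L^\infty(0,l)$ be real-valued. Write $\overline{f}$ and $\underline{f}$ for the essential supremum and infimum of $f$ over $(0,l)$, and assume $\underline{\rho},\underline{I_w},\underline{EI},\underline{GJ},\underline{\eta_\omega},\underline{\eta_\phi}>0$. Let $k_1,k_2\ge 0$ and $\epsilon_1,\epsilon_2>0$. Elements of $H^1(0,l)$ are identified with their absolutely continuous representatives on $[0,l]$. Let $$\mathcal H=\{(f,g,h,z)\in H^2(0,l)\times L^2(0,l)\times H^1(0,l)\times L^2(0,l): f(0)=f'(0)=0,\ h(0)=0\},$$ a real vector space, and for $X_i=(f_i,g_i,h_i,z_i)\in\mathcal H$ put $$\langle X_1,X_2\rangle_{\mathcal H,1}=\int_0^l (EI\,f_1''f_2''+\rho\, g_1g_2)\,dy+\int_0^l (GJ\,h_1'h_2'+I_w z_1z_2)\,dy,$$ $$\langle X_1,X_2\rangle_{\mathcal H,2}=\langle X_1,X_2\rangle_{\mathcal H,1}+\epsilon_1\int_0^l\rho\,(f_1g_2+g_1f_2)\,dy+\epsilon_2\int_0^l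 I_w(h_1z_2+z_1h_2)\,dy .$$ For $X=(f,g,h,z)$ write $M=EI f''+\eta_\omega EI g''$ and $N=GJ h'+\eta_\phi GJ z'$. Let $D(\mathcal A)$ be the set of all $(f,g,h,z)\in\mathcal H$ with $g\in H^2(0,l)$, $z\in H^1(0,l)$, $M\in H^2(0,l)$, $N\in H^1(0,l)$, $g(0)=g'(0)=0$, $z(0)=0$, $M(l)=0$ and $$-M'(l)+k_1\big(g(l)+\epsilon_1 f(l)\big)=0,\qquad N(l)+k_2\big(z(l)+\epsilon_2 h(l)\big)=0 .$$ Define $\mathcal A:D(\mathcal A)\to\mathcal H$ by $$\mathcal A(f,g,h,z)=\Big(g,\ -\tfrac1\rho M''+\alpha_\omega h+\beta_\omega z+\gamma_\omega g,\ z,\ \tfrac1{I_w}N'+\alpha_\phi h+\beta_\phi z+\gamma_\phi g\Big).$$ Let $\mathcal A_1(f,g,h,z)=(g,-\tfrac1\rho M'',z,\tfrac1{I_w}N')$ on $D(\mathcal A_1)=D(\mathcal A)$ and $\mathcal A_2(f,g,h,z)=(0,\alpha_\omega h+\beta_\omega z+\gamma_\omega g,0,\alpha_\phi h+\beta_\phi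 z+\gamma_\phi g)$ on $D(\mathcal A_2)=\mathcal H$. Finally let $$K_m=\max\Big(\sqrt{\overline\rho},\ \frac{16l^4\sqrt{\overline\rho}}{\pi^4\underline{EI}},\ \sqrt{\overline{I_w}},\ \frac{4l^2\sqrt{\overline{I_w}}}{\pi^2\underline{GJ}}\Big),$$ $$\epsilon_1^*=\frac{4\pi^4\,\underline{\eta_\omega EI}}{64l^4\overline\rho+\pi^4\,\overline{\eta_\omega}\,\underline{\eta_\omega EI}},\qquad \epsilon_2^*=\frac{4\pi^2\,\underline{\eta_\phi GJ}}{16l^2\overline{I_w}+\pi^2\,\overline{\eta_\phi}\,\underline{\eta_\phi GJ}} .$$ **Theorem.** Assume $0<\epsilon_1<\min(\epsilon_1^*,1/K_m)$ and $0<\epsilon_2<\min(\epsilon_2^*,1/K_m)$. Then $\mathcal A=\mathcal A_1+\mathcal A_2$, the form $\langle\cdot,\cdot\rangle_{\mathcal H,2}$ is an inner product that makes $\mathcal H$ a real Hilbert space, and $\mathcal A$ is the infinitesimal generator of a $C_0$-semigroup of bounded linear operators on $(\mathcal H,\langle\cdot,\cdot\rangle_{\mathcal H,2})$. -/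

import Mathlib

open MeasureTheory Set Filter Topology
open scoped ENNReal NNReal ContDiff

noncomputable section

namespace FlexibleWing

/-! ### Lebesgue and Sobolev spaces on `(0, l)` -/

/-- Lebesgue measure on the interval `(0, l)`. -/
abbrev mu (l : ℝ) : Measure ℝ := volume.restrict (Ioo 0 l)

/-- The real Hilbert space `L²(0, l)`. -/
abbrev L2 (l : ℝ) : Type := Lp ℝ 2 (mu l)

/-- Smooth test functions with compact support in `(0, l)`. -/
structure IsTest (l : ℝ) (φ : ℝ → ℝ) : Prop where
  smooth : ContDiff ℝ ∞ φ
  compact : HasCompactSupport φ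
  subset : tsupport φ ⊆ Ioo 0 l

/-- `v` is a weak derivative of `u` on `(0, l)`. -/
def IsWeakDeriv {l : ℝ} (u v : L2 l) : Prop :=
  ∀ φ : ℝ → ℝ, IsTest l φ → ∫ y, u y * deriv φ y ∂(mu l) = -∫ y, v y * φ y ∂(mu l)

open Classical in
/-- The weak derivative of `u`, as an element of `L²(0, l)`
(by convention `0` if `u` has no weak derivative in `L²(0, l)`). -/
def wd {l : ℝ} (u : L2 l) : L2 l := if h : ∃ v : L2 l, IsWeakDeriv u v then h.choose else 0

/-- `g` is a representative of `u` that is absolutely continuous on `[0, l]`. -/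
def IsACRep {l : ℝ} (u : L2 l) (g : ℝ → ℝ) : Prop :=
  AbsolutelyContinuousOnInterval g 0 l ∧ u =ᵐ[mu l] g

open Classical in
/-- The value `u(x)`, `x ∈ [0, l]`, of the absolutely continuous representative of `u`
(by convention `0` if there is none). -/
def val {l : ℝ} (u : L2 l) (x : ℝ) : ℝ :=
  if h : ∃ g : ℝ → ℝ, IsACRep u g then h.choose x else 0

lemma intervalInt_eq {l : ℝ} (hl : 0 < l) (f : ℝ → ℝ) : ∫ y in (0:ℝ)..l, f y = ∫ y, f y ∂(mu l) := by
  rw [intervalIntegral.integral_of_le hl.le, integral_Ioc_eq_integral_Ioo]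

lemma L2.integrable {l : ℝ} (u : L2 l) : Integrable u (mu l) :=
  (Lp.memLp u).integrable (by norm_num)

lemma integrable_mul_of_continuous {l : ℝ} {k φ : ℝ → ℝ} (hk : Integrable k (mu l))
    (hφ : Continuous φ) : Integrable (fun y => k y * φ y) (mu l) := by
  obtain ⟨C, hC⟩ := (isCompact_Icc (a := (0:ℝ)) (b := l)).exists_bound_of_continuousOn
    hφ.continuousOn
  refine hk.mul_bdd (c := C) hφ.aestronglyMeasurable ?_
  filter_upwards [ae_restrict_mem measurableSet_Ioo] with x hx
  exact hC x ⟨hx.1.le, hx.2.le⟩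

lemma IsTest.continuous {l : ℝ} {φ : ℝ → ℝ} (h : IsTest l φ) : Continuous φ := h.smooth.continuous

lemma IsTest.continuous_deriv {l : ℝ} {φ : ℝ → ℝ} (h : IsTest l φ) : Continuous (deriv φ) :=
  h.smooth.continuous_deriv (by simp)

lemma ae_zero_of_test {l : ℝ} {k : ℝ → ℝ} (hk : Integrable k (mu l))
    (h : ∀ φ, IsTest l φ → ∫ y, k y * φ y ∂(mu l) = 0) : k =ᵐ[mu l] 0 := by
  have h1 := IsOpen.ae_eq_zero_of_integral_contDiff_smul_eq_zero (μ := mu l)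
    (isOpen_Ioo (a := (0:ℝ)) (b := l)) (f := k)
    (hk.locallyIntegrable.locallyIntegrableOn _)
    (fun φ h1 h2 h3 => by simpa [mul_comm] using h φ ⟨h1, h2, h3⟩)
  filter_upwards [h1, ae_restrict_mem measurableSet_Ioo] with x hx hx'
  exact hx hx'

lemma IsWeakDeriv.unique {l : ℝ} {u v w : L2 l} (hv : IsWeakDeriv u v) (hw : IsWeakDeriv u w) :
    v = w := by
  have hi : Integrable (fun y => v y - w y) (mu l) := v.integrable.sub w.integrable
  have := ae_zero_of_test hi (fun φ hφ => by
    have h1 := hv φ hφ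
    have h2 := hw φ hφ
    simp only [sub_mul]
    rw [integral_sub (integrable_mul_of_continuous v.integrable hφ.continuous)
      (integrable_mul_of_continuous w.integrable hφ.continuous)]
    linarith)
  refine Lp.ext ?_
  filter_upwards [this] with x hx
  simpa [sub_eq_zero] using hx

lemma IsWeakDeriv.wd_eq {l : ℝ} {u v : L2 l} (h : IsWeakDeriv u v) : wd u = v := by
  have h' : ∃ v : L2 l, IsWeakDeriv u v := ⟨v, h⟩
  rw [wd, dif_pos h']
  exact h'.choose_spec.unique h

lemma IsWeakDeriv.add {l : ℝ} {u v u' v' : L2 l} (h : IsWeakDeriv u v) (h' : IsWeakDeriv u' v') :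
    IsWeakDeriv (u + u') (v + v') := by
  intro φ hφ
  have e1 : ∫ y, (u + u') y * deriv φ y ∂(mu l)
      = ∫ y, (u y * deriv φ y + u' y * deriv φ y) ∂(mu l) := by
    refine integral_congr_ae ?_
    filter_upwards [Lp.coeFn_add u u'] with x hx
    rw [hx, Pi.add_apply, add_mul]
  have e2 : ∫ y, (v + v') y * φ y ∂(mu l) = ∫ y, (v y * φ y + v' y * φ y) ∂(mu l) := by
    refine integral_congr_ae ?_
    filter_upwards [Lp.coeFn_add v v'] with x hx
    rw [hx, Pi.add_apply, add_mul]
  rw [e1, e2, integral_add (integrable_mul_of_continuous u.integrable hφ.continuous_deriv)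
    (integrable_mul_of_continuous u'.integrable hφ.continuous_deriv),
    integral_add (integrable_mul_of_continuous v.integrable hφ.continuous)
    (integrable_mul_of_continuous v'.integrable hφ.continuous), h φ hφ, h' φ hφ]
  ring

lemma IsWeakDeriv.smul {l : ℝ} {u v : L2 l} (c : ℝ) (h : IsWeakDeriv u v) :
    IsWeakDeriv (c • u) (c • v) := by
  intro φ hφ
  have e1 : ∫ y, (c • u) y * deriv φ y ∂(mu l) = ∫ y, c * (u y * deriv φ y) ∂(mu l) := by
    refine integral_congr_ae ?_
    filter_upwards [Lp.coeFn_smul c u] with x hx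
    rw [hx, Pi.smul_apply, smul_eq_mul, mul_assoc]
  have e2 : ∫ y, (c • v) y * φ y ∂(mu l) = ∫ y, c * (v y * φ y) ∂(mu l) := by
    refine integral_congr_ae ?_
    filter_upwards [Lp.coeFn_smul c v] with x hx
    rw [hx, Pi.smul_apply, smul_eq_mul, mul_assoc]
  rw [e1, e2, integral_const_mul, integral_const_mul, h φ hφ]
  ring

lemma IsWeakDeriv.zero {l : ℝ} : IsWeakDeriv (0 : L2 l) 0 := by
  have h : ∀ f : ℝ → ℝ, ∫ y, (0 : L2 l) y * f y ∂(mu l) = 0 := by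
    intro f
    rw [← integral_zero ℝ ℝ (μ := mu l)]
    refine integral_congr_ae ?_
    filter_upwards [Lp.coeFn_zero ℝ 2 (mu l)] with x hx
    rw [hx, Pi.zero_apply, zero_mul]
  intro φ _
  rw [h, h, neg_zero]

/-- The Sobolev space `H¹(0, l)`. -/
def H1 (l : ℝ) : Submodule ℝ (L2 l) where
  carrier := {u | ∃ v : L2 l, IsWeakDeriv u v}
  add_mem' := by
    rintro u u' ⟨v, h⟩ ⟨v', h'⟩
    exact ⟨_, h.add h'⟩
  zero_mem' := ⟨0, .zero⟩
  smul_mem' := by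
    rintro c u ⟨v, h⟩
    exact ⟨_, h.smul c⟩

lemma isWeakDeriv_wd {l : ℝ} {u : L2 l} (h : u ∈ H1 l) : IsWeakDeriv u (wd u) := by
  obtain ⟨v, hv⟩ := h
  rwa [hv.wd_eq]

lemma wd_add {l : ℝ} {u v : L2 l} (hu : u ∈ H1 l) (hv : v ∈ H1 l) : wd (u + v) = wd u + wd v :=
  ((isWeakDeriv_wd hu).add (isWeakDeriv_wd hv)).wd_eq

lemma wd_smul {l : ℝ} {u : L2 l} (c : ℝ) (hu : u ∈ H1 l) : wd (c • u) = c • wd u :=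
  ((isWeakDeriv_wd hu).smul c).wd_eq

@[simp] lemma wd_zero {l : ℝ} : wd (0 : L2 l) = 0 := IsWeakDeriv.zero.wd_eq

/-- The Sobolev space `H²(0, l)`. -/
def H2 (l : ℝ) : Submodule ℝ (L2 l) where
  carrier := {u | u ∈ H1 l ∧ wd u ∈ H1 l}
  add_mem' := by
    rintro u u' ⟨h1, h2⟩ ⟨h1', h2'⟩
    refine ⟨add_mem h1 h1', ?_⟩
    rw [wd_add h1 h1']
    exact add_mem h2 h2'
  zero_mem' := ⟨zero_mem _, by rw [wd_zero]; exact zero_mem _⟩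
  smul_mem' := by
    rintro c u ⟨h1, h2⟩
    refine ⟨Submodule.smul_mem _ c h1, ?_⟩
    rw [wd_smul c h1]
    exact Submodule.smul_mem _ c h2

lemma wd_wd_add {l : ℝ} {u v : L2 l} (hu : u ∈ H2 l) (hv : v ∈ H2 l) :
    wd (wd (u + v)) = wd (wd u) + wd (wd v) := by
  rw [wd_add hu.1 hv.1, wd_add hu.2 hv.2]

lemma wd_wd_smul {l : ℝ} {u : L2 l} (c : ℝ) (hu : u ∈ H2 l) :
    wd (wd (c • u)) = c • wd (wd u) := by
  rw [wd_smul c hu.1, wd_smul c hu.2]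

/-- Test functions: there is one of integral `1`. -/
lemma exists_test_integral_one {l : ℝ} (hl : 0 < l) :
    ∃ ψ, IsTest l ψ ∧ ∫ y, ψ y ∂(mu l) = 1 := by
  let b : ContDiffBump (l / 2) := ⟨l / 8, l / 4, by positivity, by linarith⟩
  have hs : tsupport (b.normed volume) ⊆ Ioo 0 l := by
    rw [b.tsupport_normed_eq, Real.closedBall_eq_Icc]
    exact fun x hx => ⟨by have := hx.1; simp only [b] at this; linarith,
      by have := hx.2; simp only [b] at this; linarith⟩
  refine ⟨b.normed volume, ⟨b.contDiff_normed, b.hasCompactSupport_normed, hs⟩, ?_⟩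
  rw [setIntegral_eq_integral_of_forall_compl_eq_zero, b.integral_normed]
  intro x hx
  exact image_eq_zero_of_notMem_tsupport fun h => hx (hs h)

/-- A test function of integral `0` is the derivative of a test function. -/
lemma exists_test_primitive {l : ℝ} (hl : 0 < l) {θ : ℝ → ℝ} (hθ : IsTest l θ)
    (h0 : ∫ y, θ y ∂(mu l) = 0) : ∃ χ, IsTest l χ ∧ deriv χ = θ := by
  have hc : Continuous θ := hθ.continuous
  have hd : ∀ x, HasDerivAt (fun x => ∫ t in (0:ℝ)..x, θ t) (θ x) x := fun x =>
    intervalIntegral.integral_hasDerivAt_right (hc.intervalIntegrable _ _)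
      hc.aestronglyMeasurable.stronglyMeasurableAtFilter hc.continuousAt
  have hde : deriv (fun x => ∫ t in (0:ℝ)..x, θ t) = θ := funext fun x => (hd x).deriv
  obtain ⟨a, b, ha, hb, hab⟩ : ∃ a b : ℝ, 0 < a ∧ b < l ∧ tsupport θ ⊆ Icc a b := by
    rcases (tsupport θ).eq_empty_or_nonempty with he | hne
    · exact ⟨l / 2, l / 2, by linarith, by linarith, by simp [he]⟩
    · have hk : IsCompact (tsupport θ) := hθ.compact
      exact ⟨sInf (tsupport θ), sSup (tsupport θ), (hθ.subset (hk.sInf_mem hne)).1,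
        (hθ.subset (hk.sSup_mem hne)).2,
        fun x hx => ⟨csInf_le hk.bddBelow hx, le_csSup hk.bddAbove hx⟩⟩
  have hz : ∀ x, x ∉ Icc a b → θ x = 0 := fun x hx =>
    image_eq_zero_of_notMem_tsupport fun h => hx (hab h)
  have hsupp : Function.support (fun x => ∫ t in (0:ℝ)..x, θ t) ⊆ Icc a b := by
    intro x hx
    by_contra hxn
    apply hx
    rcases lt_or_ge x a with h | h
    · have : EqOn θ (fun _ => 0) (uIcc 0 x) := fun t ht => hz t fun ht' => by
        have := (mem_uIcc.1 ht)
        have := ht'.1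
        grind
      simp only
      rw [intervalIntegral.integral_congr this]
      simp
    · have hbx : b < x := by
        by_contra hh
        exact hxn ⟨h, not_lt.1 hh⟩
      have h1 : EqOn θ (fun _ => 0) (uIcc l x) := fun t ht => hz t fun ht' => by
        have := (mem_uIcc.1 ht)
        have := ht'.2
        grind
      simp only
      rw [← intervalIntegral.integral_add_adjacent_intervals (hc.intervalIntegrable 0 l)
        (hc.intervalIntegrable l x), intervalIntegral.integral_congr h1, intervalInt_eq hl, h0]
      simp
  have hts : tsupport (fun x => ∫ t in (0:ℝ)..x, θ t) ⊆ Icc a b :=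
    closure_minimal hsupp isClosed_Icc
  refine ⟨fun x => ∫ t in (0:ℝ)..x, θ t, ⟨?_, ?_, ?_⟩, hde⟩
  · rw [contDiff_infty_iff_deriv, hde]
    exact ⟨fun x => (hd x).differentiableAt, hθ.smooth⟩
  · exact HasCompactSupport.of_support_subset_isCompact isCompact_Icc hsupp
  · exact hts.trans fun x hx => ⟨ha.trans_le hx.1, hx.2.trans_lt hb⟩

lemma IsTest.add_smul {l c : ℝ} {φ ψ : ℝ → ℝ} (h : IsTest l φ) (h' : IsTest l ψ) :
    IsTest l (fun y => φ y - c * ψ y) := by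
  have hs : Function.support (fun y => φ y - c * ψ y) ⊆ tsupport φ ∪ tsupport ψ := by
    intro y hy
    by_contra hn
    rw [mem_union, not_or] at hn
    apply hy
    simp [image_eq_zero_of_notMem_tsupport hn.1, image_eq_zero_of_notMem_tsupport hn.2]
  have hk : IsCompact (tsupport φ ∪ tsupport ψ) := IsCompact.union h.compact h'.compact
  exact ⟨h.smooth.sub (contDiff_const.mul h'.smooth), .of_support_subset_isCompact hk hs,
    (closure_minimal hs hk.isClosed).trans (union_subset h.subset h'.subset)⟩

/-- Every element of `H¹(0, l)` has an absolutely continuous representative. -/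
lemma exists_isACRep {l : ℝ} (hl : 0 < l) {u : L2 l} (hu : u ∈ H1 l) : ∃ g, IsACRep u g := by
  obtain ⟨v, hv⟩ := hu
  have hvi : IntervalIntegrable v volume 0 l := by
    rw [intervalIntegrable_iff_integrableOn_Ioo_of_le hl.le]
    exact v.integrable
  let w : ℝ → ℝ := fun x => ∫ t in (0:ℝ)..x, v t
  have hw : AbsolutelyContinuousOnInterval w 0 l :=
    hvi.absolutelyContinuousOnInterval_intervalIntegral (by simp)
  have hwi : Integrable w (mu l) := by
    have := (hw.continuousOn.intervalIntegrable : IntervalIntegrable w volume 0 l)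
    rw [intervalIntegrable_iff_integrableOn_Ioo_of_le hl.le] at this
    exact this
  have hwd : ∀ φ, IsTest l φ → ∫ y, w y * deriv φ y ∂(mu l) = -∫ y, v y * φ y ∂(mu l) := by
    intro φ hφ
    have hφa : AbsolutelyContinuousOnInterval φ 0 l :=
      ContDiffOn.absolutelyContinuousOnInterval (hφ.smooth.of_le (by simp)).contDiffOn
    have e := hw.integral_mul_deriv_eq_deriv_mul hφa
    have z0 : φ 0 = 0 := image_eq_zero_of_notMem_tsupport fun h => lt_irrefl _ (hφ.subset h).1
    have z1 : φ l = 0 := image_eq_zero_of_notMem_tsupport fun h => lt_irrefl _ (hφ.subset h).2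
    have e2 : ∫ y in (0:ℝ)..l, deriv w y * φ y = ∫ y in (0:ℝ)..l, v y * φ y := by
      refine intervalIntegral.integral_congr_ae ?_
      filter_upwards [hvi.ae_hasDerivAt_integral] with x hx hx'
      rw [(hx (uIoc_subset_uIcc hx') 0 (by simp)).deriv]
    rw [← intervalInt_eq hl, e, e2, z0, z1, intervalInt_eq hl]
    simp
  have hki : Integrable (fun y => u y - w y) (mu l) := u.integrable.sub hwi
  have hk : ∀ φ, IsTest l φ → ∫ y, (u y - w y) * deriv φ y ∂(mu l) = 0 := by
    intro φ hφ
    simp only [sub_mul]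
    rw [integral_sub (integrable_mul_of_continuous u.integrable hφ.continuous_deriv)
      (integrable_mul_of_continuous hwi hφ.continuous_deriv), hwd φ hφ, hv φ hφ, sub_self]
  obtain ⟨ψ, hψ, hψ1⟩ := exists_test_integral_one hl
  set c : ℝ := ∫ y, (u y - w y) * ψ y ∂(mu l) with hc
  have one : Integrable (fun _ : ℝ => (1:ℝ)) (mu l) := integrable_const 1
  have hti : ∀ φ, IsTest l φ → Integrable φ (mu l) := fun φ hφ => by
    simpa using integrable_mul_of_continuous one hφ.continuous
  have hcon : (fun y => (u y - w y) - c) =ᵐ[mu l] 0 := by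
    refine ae_zero_of_test (hki.sub (integrable_const c)) fun φ hφ => ?_
    set m : ℝ := ∫ y, φ y ∂(mu l) with hm
    obtain ⟨χ, hχ, hχd⟩ := exists_test_primitive hl (hφ.add_smul (c := m) hψ) (by
      rw [integral_sub (hti φ hφ) ((hti ψ hψ).const_mul m), integral_const_mul, hψ1, ← hm]
      ring)
    have e := hk χ hχ
    rw [hχd] at e
    have i1 := integrable_mul_of_continuous hki hφ.continuous
    have i2 := integrable_mul_of_continuous hki hψ.continuous
    have e1 : ∫ y, (u y - w y) * (φ y - m * ψ y) ∂(mu l)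
        = ∫ y, (u y - w y) * φ y ∂(mu l) - m * c := by
      rw [hc, ← integral_const_mul, ← integral_sub i1 (i2.const_mul m)]
      congr 1
      ext y
      ring
    have e2 : ∫ y, ((u y - w y) - c) * φ y ∂(mu l)
        = ∫ y, (u y - w y) * φ y ∂(mu l) - c * m := by
      rw [hm, ← integral_const_mul, ← integral_sub i1 ((hti φ hφ).const_mul c)]
      congr 1
      ext y
      ring
    rw [e2]
    linarith
  refine ⟨fun x => w x + c, ?_, ?_⟩
  · have hcc : AbsolutelyContinuousOnInterval (fun _ : ℝ => c) 0 l :=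
      ContDiffOn.absolutelyContinuousOnInterval contDiffOn_const
    exact hw.add hcc
  · filter_upwards [hcon] with x hx
    have : u x - w x - c = 0 := hx
    linarith

lemma IsACRep.val_eq {l : ℝ} (hl : 0 < l) {u : L2 l} {g : ℝ → ℝ} (hg : IsACRep u g) {x : ℝ}
    (hx : x ∈ Icc 0 l) : val u x = g x := by
  have h' : ∃ g, IsACRep u g := ⟨g, hg⟩
  rw [val, dif_pos h']
  have hs := h'.choose_spec
  have hu : uIcc 0 l = Icc 0 l := uIcc_of_le hl.le
  refine Measure.eqOn_Icc_of_ae_eq (μ := volume) hl.ne ?_ (hu ▸ hs.1.continuousOn)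
    (hu ▸ hg.1.continuousOn) hx
  rw [← restrict_Ioo_eq_restrict_Icc]
  exact hs.2.symm.trans hg.2

lemma val_add {l : ℝ} (hl : 0 < l) {u v : L2 l} (hu : u ∈ H1 l) (hv : v ∈ H1 l) {x : ℝ}
    (hx : x ∈ Icc 0 l) : val (u + v) x = val u x + val v x := by
  obtain ⟨g, hg⟩ := exists_isACRep hl hu
  obtain ⟨k, hk⟩ := exists_isACRep hl hv
  have : IsACRep (u + v) (g + k) := ⟨hg.1.add hk.1, (Lp.coeFn_add u v).trans (hg.2.add hk.2)⟩
  rw [this.val_eq hl hx, hg.val_eq hl hx, hk.val_eq hl hx, Pi.add_apply]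

lemma val_smul {l : ℝ} (hl : 0 < l) {u : L2 l} (c : ℝ) (hu : u ∈ H1 l) {x : ℝ}
    (hx : x ∈ Icc 0 l) : val (c • u) x = c * val u x := by
  obtain ⟨g, hg⟩ := exists_isACRep hl hu
  have : IsACRep (c • u) (c • g) :=
    ⟨hg.1.const_smul c, (Lp.coeFn_smul c u).trans (hg.2.const_smul c)⟩
  rw [this.val_eq hl hx, hg.val_eq hl hx, Pi.smul_apply, smul_eq_mul]

lemma val_zero {l : ℝ} (hl : 0 < l) {x : ℝ} (hx : x ∈ Icc 0 l) : val (0 : L2 l) x = 0 := by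
  simpa using val_smul hl (0 : ℝ) (zero_mem (H1 l)) hx

/-- Multiplication by an essentially bounded function, as a linear map on `L²(0, l)`. -/
def mulL {l : ℝ} {a : ℝ → ℝ} (ha : MemLp a ∞ (mu l)) : L2 l →ₗ[ℝ] L2 l where
  toFun u := ((Lp.memLp u).mul' ha : MemLp (fun y => a y * u y) 2 (mu l)).toLp _
  map_add' u v := by
    refine Lp.ext ?_
    filter_upwards [Lp.coeFn_add u v, MemLp.coeFn_toLp ((Lp.memLp (u + v)).mul' ha (r := 2)),
      MemLp.coeFn_toLp ((Lp.memLp u).mul' ha (r := 2)),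
      MemLp.coeFn_toLp ((Lp.memLp v).mul' ha (r := 2)), Lp.coeFn_add
        (((Lp.memLp u).mul' ha : MemLp (fun y => a y * u y) 2 (mu l)).toLp _)
        (((Lp.memLp v).mul' ha : MemLp (fun y => a y * v y) 2 (mu l)).toLp _)]
      with x h1 h2 h3 h4 h5
    rw [h2, h5, Pi.add_apply, h3, h4, h1, Pi.add_apply, mul_add]
  map_smul' c u := by
    refine Lp.ext ?_
    filter_upwards [Lp.coeFn_smul c u, MemLp.coeFn_toLp ((Lp.memLp (c • u)).mul' ha (r := 2)),
      MemLp.coeFn_toLp ((Lp.memLp u).mul' ha (r := 2)), Lp.coeFn_smul c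
        (((Lp.memLp u).mul' ha : MemLp (fun y => a y * u y) 2 (mu l)).toLp _)]
      with x h1 h2 h3 h4
    simp only [RingHom.id_apply]
    rw [h2, h4, Pi.smul_apply, h3, h1, Pi.smul_apply, smul_eq_mul, smul_eq_mul]
    ring

/-! ### The wing, its state space and the inner products -/

/-- The physical parameters of the wing: its length, the mass per unit span `ρ`, the moment of
inertia per unit length `Iw`, the bending and torsional stiffnesses `EI` and `GJ`, the Kelvin-Voigt
damping coefficients `ηω`, `ηφ`, and the aerodynamic coefficients. All are in `L^∞(0, l)`; the
structural ones have positive essential infimum. -/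
structure Wing where
  l : ℝ
  ρ : ℝ → ℝ
  Iw : ℝ → ℝ
  EI : ℝ → ℝ
  GJ : ℝ → ℝ
  ηω : ℝ → ℝ
  ηφ : ℝ → ℝ
  αω : ℝ → ℝ
  βω : ℝ → ℝ
  γω : ℝ → ℝ
  αφ : ℝ → ℝ
  βφ : ℝ → ℝ
  γφ : ℝ → ℝ
  l_pos : 0 < l
  ρ_mem : MemLp ρ ∞ (mu l)
  Iw_mem : MemLp Iw ∞ (mu l)
  EI_mem : MemLp EI ∞ (mu l)
  GJ_mem : MemLp GJ ∞ (mu l)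
  ηω_mem : MemLp ηω ∞ (mu l)
  ηφ_mem : MemLp ηφ ∞ (mu l)
  αω_mem : MemLp αω ∞ (mu l)
  βω_mem : MemLp βω ∞ (mu l)
  γω_mem : MemLp γω ∞ (mu l)
  αφ_mem : MemLp αφ ∞ (mu l)
  βφ_mem : MemLp βφ ∞ (mu l)
  γφ_mem : MemLp γφ ∞ (mu l)
  ρ_pos : 0 < essInf ρ (mu l)
  Iw_pos : 0 < essInf Iw (mu l)
  EI_pos : 0 < essInf EI (mu l)
  GJ_pos : 0 < essInf GJ (mu l)
  ηω_pos : 0 < essInf ηω (mu l)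
  ηφ_pos : 0 < essInf ηφ (mu l)

lemma memLp_inv {l : ℝ} {a : ℝ → ℝ} (ha : MemLp a ∞ (mu l)) (hpos : 0 < essInf a (mu l)) :
    MemLp (fun y => 1 / a y) ∞ (mu l) := by
  have hb : IsBoundedUnder (· ≥ ·) (ae (mu l)) a := by
    refine ⟨-(eLpNormEssSup a (mu l)).toReal, ?_⟩
    rw [eventually_map]
    filter_upwards [ae_le_eLpNormEssSup (f := a) (μ := mu l)] with x hx
    have hfin : eLpNormEssSup a (mu l) ≠ ⊤ := by
      have := ha.2
      rw [eLpNorm_exponent_top] at this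
      exact this.ne
    have h1 : ‖a x‖ ≤ (eLpNormEssSup a (mu l)).toReal := by
      rw [← toReal_enorm]
      exact ENNReal.toReal_mono hfin hx
    exact (abs_le.1 h1).1
  refine memLp_top_of_bound ?_ (1 / essInf a (mu l)) ?_
  · simp only [one_div]
    exact ha.aestronglyMeasurable.aemeasurable.inv.aestronglyMeasurable
  · filter_upwards [ae_essInf_le hb] with x hx
    rw [Real.norm_of_nonneg (by have := hpos.trans_le hx; positivity)]
    exact one_div_le_one_div_of_le hpos hx

namespace Wing

variable (W : Wing)

/-- `{f ∈ H²(0, l) : f(0) = f'(0) = 0}` -/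
def H2c : Submodule ℝ (L2 W.l) where
  carrier := {f | f ∈ H2 W.l ∧ val f 0 = 0 ∧ val (wd f) 0 = 0}
  add_mem' := by
    rintro u v ⟨h1, h2, h3⟩ ⟨k1, k2, k3⟩
    have h0 := left_mem_Icc.2 W.l_pos.le
    refine ⟨add_mem h1 k1, ?_, ?_⟩
    · rw [val_add W.l_pos h1.1 k1.1 h0, h2, k2, add_zero]
    · rw [wd_add h1.1 k1.1, val_add W.l_pos h1.2 k1.2 h0, h3, k3, add_zero]
  zero_mem' := by
    have h0 := left_mem_Icc.2 W.l_pos.le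
    exact ⟨zero_mem _, val_zero W.l_pos h0, by rw [wd_zero]; exact val_zero W.l_pos h0⟩
  smul_mem' := by
    rintro c u ⟨h1, h2, h3⟩
    have h0 := left_mem_Icc.2 W.l_pos.le
    refine ⟨Submodule.smul_mem _ c h1, ?_, ?_⟩
    · rw [val_smul W.l_pos c h1.1 h0, h2, mul_zero]
    · rw [wd_smul c h1.1, val_smul W.l_pos c h1.2 h0, h3, mul_zero]

/-- `{h ∈ H¹(0, l) : h(0) = 0}` -/
def H1c : Submodule ℝ (L2 W.l) where
  carrier := {h | h ∈ H1 W.l ∧ val h 0 = 0}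
  add_mem' := by
    rintro u v ⟨h1, h2⟩ ⟨k1, k2⟩
    refine ⟨add_mem h1 k1, ?_⟩
    rw [val_add W.l_pos h1 k1 (left_mem_Icc.2 W.l_pos.le), h2, k2, add_zero]
  zero_mem' := ⟨zero_mem _, val_zero W.l_pos (left_mem_Icc.2 W.l_pos.le)⟩
  smul_mem' := by
    rintro c u ⟨h1, h2⟩
    refine ⟨Submodule.smul_mem _ c h1, ?_⟩
    rw [val_smul W.l_pos c h1 (left_mem_Icc.2 W.l_pos.le), h2, mul_zero]

/-- The state space `ℋ` of all `(f, g, h, z) ∈ H² × L² × H¹ × L²` with `f(0) = f'(0) = 0` and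
`h(0) = 0`, as a bare real vector space. -/
def State : Type := W.H2c × L2 W.l × W.H1c × L2 W.l

instance : AddCommGroup W.State :=
  inferInstanceAs (AddCommGroup (W.H2c × L2 W.l × W.H1c × L2 W.l))

instance : Module ℝ W.State :=
  inferInstanceAs (Module ℝ (W.H2c × L2 W.l × W.H1c × L2 W.l))

/-- The component `f` of a state `(f, g, h, z)`. -/
def f : W.State →ₗ[ℝ] L2 W.l where
  toFun X := (X.1 : L2 W.l)
  map_add' _ _ := rfl
  map_smul' _ _ := rfl

/-- The component `g` of a state `(f, g, h, z)`. -/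
def g : W.State →ₗ[ℝ] L2 W.l where
  toFun X := X.2.1
  map_add' _ _ := rfl
  map_smul' _ _ := rfl

/-- The component `h` of a state `(f, g, h, z)`. -/
def h : W.State →ₗ[ℝ] L2 W.l where
  toFun X := (X.2.2.1 : L2 W.l)
  map_add' _ _ := rfl
  map_smul' _ _ := rfl

/-- The component `z` of a state `(f, g, h, z)`. -/
def z : W.State →ₗ[ℝ] L2 W.l where
  toFun X := X.2.2.2
  map_add' _ _ := rfl
  map_smul' _ _ := rfl

/-- The state with given components. -/
def mkState (f g h z : L2 W.l) (hf : f ∈ W.H2c) (hh : h ∈ W.H1c) : W.State :=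
  (⟨f, hf⟩, g, ⟨h, hh⟩, z)

variable {W} in
@[ext] lemma State.ext {X Y : W.State} (h1 : W.f X = W.f Y) (h2 : W.g X = W.g Y)
    (h3 : W.h X = W.h Y) (h4 : W.z X = W.z Y) : X = Y :=
  Prod.ext (Subtype.ext h1) (Prod.ext h2 (Prod.ext (Subtype.ext h3) h4))

section

variable {f g h z : L2 W.l} (hf : f ∈ W.H2c) (hh : h ∈ W.H1c)

@[simp] lemma f_mkState : W.f (W.mkState f g h z hf hh) = f := rfl
@[simp] lemma g_mkState : W.g (W.mkState f g h z hf hh) = g := rfl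
@[simp] lemma h_mkState : W.h (W.mkState f g h z hf hh) = h := rfl
@[simp] lemma z_mkState : W.z (W.mkState f g h z hf hh) = z := rfl

end

lemma f_mem (X : W.State) : W.f X ∈ W.H2c := X.1.2

lemma h_mem (X : W.State) : W.h X ∈ W.H1c := X.2.2.1.2

/-- The inner product `⟨·,·⟩_{ℋ,1}` (the energy inner product). -/
def inner1 (X Y : W.State) : ℝ :=
  ∫ y, (W.EI y * wd (wd (W.f X)) y * wd (wd (W.f Y)) y + W.ρ y * W.g X y * W.g Y y) ∂(mu W.l)
  + ∫ y, (W.GJ y * wd (W.h X) y * wd (W.h Y) y + W.Iw y * W.z X y * W.z Y y) ∂(mu W.l)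

/-- The form `⟨·,·⟩_{ℋ,2}`. -/
def inner2 (ε₁ ε₂ : ℝ) (X Y : W.State) : ℝ :=
  W.inner1 X Y
  + ε₁ * ∫ y, W.ρ y * (W.f X y * W.g Y y + W.g X y * W.f Y y) ∂(mu W.l)
  + ε₂ * ∫ y, W.Iw y * (W.h X y * W.z Y y + W.z X y * W.h Y y) ∂(mu W.l)

/-- The constant `K_m`. -/
def Km : ℝ :=
  max (max √(essSup W.ρ (mu W.l))
        (16 * W.l ^ 4 * √(essSup W.ρ (mu W.l)) / (Real.pi ^ 4 * essInf W.EI (mu W.l))))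
    (max √(essSup W.Iw (mu W.l))
        (4 * W.l ^ 2 * √(essSup W.Iw (mu W.l)) / (Real.pi ^ 2 * essInf W.GJ (mu W.l))))

/-- The constant `ε₁*`. -/
def ε₁star : ℝ :=
  4 * Real.pi ^ 4 * essInf (fun y => W.ηω y * W.EI y) (mu W.l) /
    (64 * W.l ^ 4 * essSup W.ρ (mu W.l) +
      Real.pi ^ 4 * essSup W.ηω (mu W.l) * essInf (fun y => W.ηω y * W.EI y) (mu W.l))

/-- The constant `ε₂*`. -/
def ε₂star : ℝ :=
  4 * Real.pi ^ 2 * essInf (fun y => W.ηφ y * W.GJ y) (mu W.l) /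
    (16 * W.l ^ 2 * essSup W.Iw (mu W.l) +
      Real.pi ^ 2 * essSup W.ηφ (mu W.l) * essInf (fun y => W.ηφ y * W.GJ y) (mu W.l))

/-! ### The operators -/

/-- The bending moment `EI f'' + ηω EI g''`. -/
def M (X : W.State) : L2 W.l :=
  mulL W.EI_mem (wd (wd (W.f X))) + mulL W.ηω_mem (mulL W.EI_mem (wd (wd (W.g X))))

/-- The torque `GJ h' + ηφ GJ z'`. -/
def N (X : W.State) : L2 W.l :=
  mulL W.GJ_mem (wd (W.h X)) + mulL W.ηφ_mem (mulL W.GJ_mem (wd (W.z X)))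

variable {W} in
lemma M_add {X Y : W.State} (hX : W.g X ∈ W.H2c) (hY : W.g Y ∈ W.H2c) :
    W.M (X + Y) = W.M X + W.M Y := by
  simp only [M, map_add, wd_wd_add (W.f_mem X).1 (W.f_mem Y).1, wd_wd_add hX.1 hY.1]
  abel

variable {W} in
lemma M_smul {X : W.State} (c : ℝ) (hX : W.g X ∈ W.H2c) : W.M (c • X) = c • W.M X := by
  simp only [M, map_smul, wd_wd_smul c (W.f_mem X).1, wd_wd_smul c hX.1, smul_add]

variable {W} in
lemma N_add {X Y : W.State} (hX : W.z X ∈ W.H1c) (hY : W.z Y ∈ W.H1c) :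
    W.N (X + Y) = W.N X + W.N Y := by
  simp only [N, map_add, wd_add (W.h_mem X).1 (W.h_mem Y).1, wd_add hX.1 hY.1]
  abel

variable {W} in
lemma N_smul {X : W.State} (c : ℝ) (hX : W.z X ∈ W.H1c) : W.N (c • X) = c • W.N X := by
  simp only [N, map_smul, wd_smul c (W.h_mem X).1, wd_smul c hX.1, smul_add]

lemma M_zero : W.M 0 = 0 := by simp [M]

lemma N_zero : W.N 0 = 0 := by simp [N]

/-- The domain `D(𝒜_d)`. -/
def domAd : Submodule ℝ W.State where
  carrier := {X | W.g X ∈ W.H2c ∧ W.z X ∈ W.H1c ∧ W.M X ∈ H2 W.l ∧ W.N X ∈ H1 W.l ∧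
    val (W.M X) W.l = 0}
  add_mem' := by
    rintro X Y ⟨h1, h2, h3, h4, h5⟩ ⟨k1, k2, k3, k4, k5⟩
    refine ⟨by rw [map_add]; exact add_mem h1 k1, by rw [map_add]; exact add_mem h2 k2,
      by rw [M_add h1 k1]; exact add_mem h3 k3, by rw [N_add h2 k2]; exact add_mem h4 k4, ?_⟩
    rw [M_add h1 k1, val_add W.l_pos h3.1 k3.1 (right_mem_Icc.2 W.l_pos.le), h5, k5, add_zero]
  zero_mem' := by
    refine ⟨by rw [map_zero]; exact zero_mem _, by rw [map_zero]; exact zero_mem _,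
      by rw [M_zero]; exact zero_mem _, by rw [N_zero]; exact zero_mem _, ?_⟩
    rw [M_zero, val_zero W.l_pos (right_mem_Icc.2 W.l_pos.le)]
  smul_mem' := by
    rintro c X ⟨h1, h2, h3, h4, h5⟩
    refine ⟨by rw [map_smul]; exact Submodule.smul_mem _ c h1,
      by rw [map_smul]; exact Submodule.smul_mem _ c h2,
      by rw [M_smul c h1]; exact Submodule.smul_mem _ c h3,
      by rw [N_smul c h2]; exact Submodule.smul_mem _ c h4, ?_⟩
    rw [M_smul c h1, val_smul W.l_pos c h3.1 (right_mem_Icc.2 W.l_pos.le), h5, mul_zero]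

/-- The operator `𝒜_d (f, g, h, z) = (g, g̃, z, z̃)` on `D(𝒜_d)`, where
`g̃ = -(1/ρ) (EI f'' + ηω EI g'')'' + αω h + βω z + γω g` and
`z̃ = (1/Iw) (GJ h' + ηφ GJ z')' + αφ h + βφ z + γφ g`. -/
def Ad : W.State →ₗ.[ℝ] W.State where
  domain := W.domAd
  toFun :=
    { toFun := fun X => W.mkState
        (W.g X)
        (-mulL (memLp_inv W.ρ_mem W.ρ_pos) (wd (wd (W.M X)))
          + mulL W.αω_mem (W.h X) + mulL W.βω_mem (W.z X) + mulL W.γω_mem (W.g X))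
        (W.z X)
        (mulL (memLp_inv W.Iw_mem W.Iw_pos) (wd (W.N X))
          + mulL W.αφ_mem (W.h X) + mulL W.βφ_mem (W.z X) + mulL W.γφ_mem (W.g X))
        X.2.1 X.2.2.1
      map_add' := by
        rintro ⟨X, h1, h2, h3, h4, h5⟩ ⟨Y, k1, k2, k3, k4, k5⟩
        ext1 <;> simp only [Submodule.coe_add, f_mkState, g_mkState, h_mkState, z_mkState, map_add,
          M_add h1 k1, N_add h2 k2, wd_wd_add h3 k3, wd_add h4 k4] <;> abel
      map_smul' := by
        rintro c ⟨X, h1, h2, h3, h4, h5⟩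
        ext1 <;> simp only [Submodule.coe_smul, f_mkState, g_mkState, h_mkState, z_mkState,
          map_smul, M_smul c h1, N_smul c h2, wd_wd_smul c h3, wd_smul c h4, RingHom.id_apply,
          smul_add, smul_neg] }

/-- The boundary operator `ℬ` on `D(ℬ) = D(𝒜_d)`, with gains `k₁, k₂`:
`ℬ (f, g, h, z) = (-(EI f'' + ηω EI g'')'(l) + k₁ (g(l) + ε₁ f(l)),
(GJ h' + ηφ GJ z')(l) + k₂ (z(l) + ε₂ h(l)))`. -/
def B (k₁ k₂ ε₁ ε₂ : ℝ) : W.State →ₗ.[ℝ] ℝ × ℝ where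
  domain := W.domAd
  toFun :=
    { toFun := fun X =>
        (-val (wd (W.M X)) W.l + k₁ * (val (W.g X) W.l + ε₁ * val (W.f X) W.l),
          val (W.N X) W.l + k₂ * (val (W.z X) W.l + ε₂ * val (W.h X) W.l))
      map_add' := by
        rintro ⟨X, h1, h2, h3, h4, h5⟩ ⟨Y, k1, k2, k3, k4, k5⟩
        have hl := right_mem_Icc.2 W.l_pos.le
        ext <;> simp only [Submodule.coe_add, map_add, M_add h1 k1, N_add h2 k2,
          wd_add h3.1 k3.1, val_add W.l_pos h3.2 k3.2 hl, val_add W.l_pos h4 k4 hl,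
          val_add W.l_pos h1.1.1 k1.1.1 hl, val_add W.l_pos h2.1 k2.1 hl,
          val_add W.l_pos (W.f_mem X).1.1 (W.f_mem Y).1.1 hl,
          val_add W.l_pos (W.h_mem X).1 (W.h_mem Y).1 hl, Prod.fst_add, Prod.snd_add] <;> ring
      map_smul' := by
        rintro c ⟨X, h1, h2, h3, h4, h5⟩
        have hl := right_mem_Icc.2 W.l_pos.le
        ext <;> simp only [Submodule.coe_smul, map_smul, M_smul c h1, N_smul c h2,
          wd_smul c h3.1, val_smul W.l_pos c h3.2 hl, val_smul W.l_pos c h4 hl,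
          val_smul W.l_pos c h1.1.1 hl, val_smul W.l_pos c h2.1 hl,
          val_smul W.l_pos c (W.f_mem X).1.1 hl, val_smul W.l_pos c (W.h_mem X).1 hl,
          Prod.smul_fst, Prod.smul_snd, RingHom.id_apply, smul_eq_mul] <;> ring }

/-- `ker ℬ`, a subspace of `ℋ`. -/
def kerB (k₁ k₂ ε₁ ε₂ : ℝ) : Submodule ℝ W.State :=
  (LinearMap.ker (W.B k₁ k₂ ε₁ ε₂).toFun).map (W.B k₁ k₂ ε₁ ε₂).domain.subtype

/-- The closed-loop operator `𝒜`: the restriction of `𝒜_d` to `D(𝒜) = D(𝒜_d) ∩ ker ℬ`. -/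
def A (k₁ k₂ ε₁ ε₂ : ℝ) : W.State →ₗ.[ℝ] W.State := W.Ad.domRestrict (W.kerB k₁ k₂ ε₁ ε₂)

/-- The structural part `𝒜₁ (f, g, h, z) =
(g, -(1/ρ) (EI f'' + ηω EI g'')'', z, (1/Iw) (GJ h' + ηφ GJ z')')` on `D(𝒜₁) = D(𝒜)`. -/
def A1 (k₁ k₂ ε₁ ε₂ : ℝ) : W.State →ₗ.[ℝ] W.State where
  domain := (W.A k₁ k₂ ε₁ ε₂).domain
  toFun :=
    { toFun := fun X => W.mkState
        (W.g X)
        (-mulL (memLp_inv W.ρ_mem W.ρ_pos) (wd (wd (W.M X))))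
        (W.z X)
        (mulL (memLp_inv W.Iw_mem W.Iw_pos) (wd (W.N X)))
        X.2.2.1 X.2.2.2.1
      map_add' := by
        rintro ⟨X, -, h1, h2, h3, h4, h5⟩ ⟨Y, -, k1, k2, k3, k4, k5⟩
        ext1 <;> simp only [Submodule.coe_add, f_mkState, g_mkState, h_mkState, z_mkState, map_add,
          M_add h1 k1, N_add h2 k2, wd_wd_add h3 k3, wd_add h4 k4, neg_add]
      map_smul' := by
        rintro c ⟨X, -, h1, h2, h3, h4, h5⟩
        ext1 <;> simp only [Submodule.coe_smul, f_mkState, g_mkState, h_mkState, z_mkState,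
          map_smul, M_smul c h1, N_smul c h2, wd_wd_smul c h3, wd_smul c h4, RingHom.id_apply,
          smul_neg] }

/-- The aerodynamic coupling `𝒜₂ (f, g, h, z) =
(0, αω h + βω z + γω g, 0, αφ h + βφ z + γφ g)`, defined on all of `ℋ`. -/
def A2 : W.State →ₗ[ℝ] W.State where
  toFun X := W.mkState
    0
    (mulL W.αω_mem (W.h X) + mulL W.βω_mem (W.z X) + mulL W.γω_mem (W.g X))
    0
    (mulL W.αφ_mem (W.h X) + mulL W.βφ_mem (W.z X) + mulL W.γφ_mem (W.g X))
    (zero_mem _) (zero_mem _)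
  map_add' X Y := by
    ext1 <;> simp only [f_mkState, g_mkState, h_mkState, z_mkState, map_add] <;> abel
  map_smul' c X := by
    ext1 <;> simp only [f_mkState, g_mkState, h_mkState, z_mkState, map_smul, RingHom.id_apply,
      smul_add, smul_zero]

end Wing

/-! ### Strongly continuous semigroups -/

/-- A `C₀`-semigroup of bounded linear operators on a real normed space. -/
structure C0Semigroup (E : Type*) [NormedAddCommGroup E] [NormedSpace ℝ E] where
  T : ℝ≥0 → E →L[ℝ] E
  map_zero : T 0 = ContinuousLinearMap.id ℝ E
  map_add : ∀ s t : ℝ≥0, T (s + t) = (T s).comp (T t)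
  strong : ∀ x : E, Tendsto (fun t : ℝ≥0 => T t x) (𝓝[>] 0) (𝓝 x)

/-- `A` is the infinitesimal generator of `S`: `x ∈ D(A)` and `A x = y` hold if and only if
`(T(t) x - x) / t` tends to `y` as `t` decreases to `0`. -/
def C0Semigroup.HasGenerator {E : Type*} [NormedAddCommGroup E] [NormedSpace ℝ E]
    (S : C0Semigroup E) (A : E →ₗ.[ℝ] E) : Prop :=
  ∀ x y : E, (∃ hx : x ∈ A.domain, A ⟨x, hx⟩ = y) ↔
    Tendsto (fun t : ℝ≥0 => (t : ℝ)⁻¹ • (S.T t x - x)) (𝓝[>] 0) (𝓝 y)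

/-- The real vector space `E`, with the inner product `c`, is a Hilbert space. -/
def IsHilbert {E : Type*} [AddCommGroup E] [Module ℝ E] (c : InnerProductSpace.Core ℝ E) : Prop :=
  letI : NormedAddCommGroup E := c.toNormedAddCommGroup
  CompleteSpace E

/-- `A` generates a `C₀`-semigroup on the space `E` with the norm of the inner product `c`. -/
def GeneratesC0Semigroup {E : Type*} [AddCommGroup E] [Module ℝ E]
    (c : InnerProductSpace.Core ℝ E) (A : E →ₗ.[ℝ] E) : Prop :=
  letI : NormedAddCommGroup E := c.toNormedAddCommGroup
  letI : InnerProductSpace ℝ E := InnerProductSpace.ofCore c.toCore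
  ∃ S : C0Semigroup E, S.HasGenerator A

end FlexibleWing

end

noncomputable section

namespace FlexibleWing

/-! ### Uniformly continuous contraction semigroups -/

section Exponential

variable {E : Type*} [NormedAddCommGroup E] [NormedSpace ℝ E] [CompleteSpace E]

/-! Because f(0) = f'(0) = 0 and h(0) = 0, a state is determined by its strains p = (f'', h') and
its velocities. `Wing.coord` uses (f'', h', √ρ g, √Iw z) to identify the state space with four
copies of L²(0, l). There the structural part takes the form (p, Kq) ↦ (q, -r) with S p + D q = K*
r, where q = (g'', z'), K = (√ρ J², √Iw J) and J is the Volterra operator. This single identity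
contains both equations of motion and all conditions at the tip: J* integrates from the tip, and the
boundary feedback adds rank-one terms to the stiffness S and the damping D (`Wing.balance_iff`).

Kelvin–Voigt damping makes D coercive. Hence ⟨q, p⟩ - ⟨S p, q⟩ - ⟨D q, q⟩, the pairing of the
operator with its argument, is at most a multiple of ‖p‖². Eliminating p and r from the resolvent
equation leaves a coercive equation for q, solved by Lax–Milgram
(`exists_isQuasiMDissipative_of_damped`). The aerodynamic part is a bounded perturbation
(`IsQuasiMDissipative.add`), and the Lumer–Phillips theorem, proved through Yosida approximations,
yields the semigroup.

It remains to change the norm. Wirtinger's inequality with constant 2l/π (`norm_J_le`) bounds the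
cross terms of the second form by max(ε₁, ε₂) K_m < 1 times the energy, so this form is equivalent
to the coordinate inner product (`Wing.exists_equivalent`). Completeness and generation are
insensitive to such a change (`isHilbert_and_generates_of_equivalent`). -/

lemma hasDerivAt_exp_smul_apply (B : E →L[ℝ] E) (x : E) (t : ℝ) :
    HasDerivAt (fun s : ℝ => NormedSpace.exp (s • B) x) (NormedSpace.exp (t • B) (B x)) t :=
  (hasDerivAt_exp_smul_const B t).clm_apply (hasDerivAt_const t x) |>.congr_deriv (by simp)

lemma exp_add_smul (B : E →L[ℝ] E) (s t : ℝ) :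
    NormedSpace.exp ((s + t) • B) = NormedSpace.exp (s • B) * NormedSpace.exp (t • B) := by
  let : NormedAlgebra ℚ (E →L[ℝ] E) := NormedAlgebra.restrictScalars ℚ ℝ _
  rw [add_smul]
  exact NormedSpace.exp_add_of_commute (((Commute.refl B).smul_left s).smul_right t)

omit [CompleteSpace E] in
lemma commute_exp_smul {B C : E →L[ℝ] E} (h : Commute B C) (t : ℝ) :
    Commute B (NormedSpace.exp (t • C)) := by
  exact (h.smul_right t).exp_right

/-- `exp (t B)` is a contraction for all `t ≥ 0`. -/
def ContractiveExp (B : E →L[ℝ] E) : Prop :=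
  ∀ t : ℝ, 0 ≤ t → ∀ x, ‖NormedSpace.exp (t • B) x‖ ≤ ‖x‖

/-- The path s ↦ exp(sB) exp((t-s)C) x joins the two vectors. As B and C commute, its derivative is
exp(sB) exp((t-s)C)(Bx - Cx), of norm at most ‖Bx - Cx‖. -/
lemma ContractiveExp.norm_sub_le {B C : E →L[ℝ] E} (hB : ContractiveExp B)
    (hC : ContractiveExp C) (h : Commute B C) {t : ℝ} (ht : 0 ≤ t) (x : E) :
    ‖NormedSpace.exp (t • B) x - NormedSpace.exp (t • C) x‖ ≤ t * ‖B x - C x‖ := by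
  have hd : ∀ s : ℝ, HasDerivAt
      (fun s : ℝ => NormedSpace.exp (s • B) (NormedSpace.exp ((t - s) • C) x))
      (NormedSpace.exp (s • B) (NormedSpace.exp ((t - s) • C) (B x - C x))) s := by
    intro s
    have h1 := hasDerivAt_exp_smul_const B s
    have h2 : HasDerivAt (fun s : ℝ => NormedSpace.exp ((t - s) • C) x)
        (-(NormedSpace.exp ((t - s) • C) (C x))) s := by
      have := (hasDerivAt_exp_smul_apply C x (t - s)).scomp s ((hasDerivAt_id s).const_sub t)
      exact this.congr_deriv (by simp)
    refine (h1.clm_apply h2).congr_deriv ?_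
    have h3 : B (NormedSpace.exp ((t - s) • C) x) = NormedSpace.exp ((t - s) • C) (B x) :=
      congrArg (fun T : E →L[ℝ] E => T x) (commute_exp_smul h (t - s)).eq
    simp only [ContinuousLinearMap.mul_def, ContinuousLinearMap.comp_apply, h3, map_sub, map_neg]
    abel
  have := norm_image_sub_le_of_norm_deriv_le_segment' (a := 0) (b := t) (C := ‖B x - C x‖)
    (fun s _ => (hd s).hasDerivWithinAt)
    (fun s hs => (hB s hs.1 _).trans (hC (t - s) (by linarith [hs.2]) _)) t ⟨ht, le_rfl⟩
  simpa [mul_comm] using this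

omit [CompleteSpace E] in
lemma contractiveExp_zero : ContractiveExp (0 : E →L[ℝ] E) := fun t _ x => by simp

lemma ContractiveExp.norm_sub_self_le {B : E →L[ℝ] E} (hB : ContractiveExp B) {t : ℝ}
    (ht : 0 ≤ t) (x : E) : ‖NormedSpace.exp (t • B) x - x‖ ≤ t * ‖B x‖ := by
  simpa using hB.norm_sub_le contractiveExp_zero (Commute.zero_right B) ht x

/-- A first-order Taylor estimate that avoids B²x. For Yosida approximations of an unbounded
operator B²x need not stay bounded, whereas By does when y lies in the domain; y is later taken
close to the limit of Bx. -/
lemma ContractiveExp.norm_sub_sub_le {B : E →L[ℝ] E} (hB : ContractiveExp B) {t : ℝ}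
    (ht : 0 ≤ t) (x y : E) :
    ‖NormedSpace.exp (t • B) x - x - t • B x‖ ≤ t * (2 * ‖B x - y‖ + t * ‖B y‖) := by
  have hd : ∀ s : ℝ, HasDerivAt (fun s : ℝ => NormedSpace.exp (s • B) x - s • B x)
      (NormedSpace.exp (s • B) (B x) - B x) s := fun s =>
    ((hasDerivAt_exp_smul_apply B x s).sub ((hasDerivAt_id s).smul_const (B x))).congr_deriv
      (by simp)
  have hb : ∀ s ∈ Ico (0:ℝ) t,
      ‖NormedSpace.exp (s • B) (B x) - B x‖ ≤ 2 * ‖B x - y‖ + t * ‖B y‖ := by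
    intro s hs
    have e : NormedSpace.exp (s • B) (B x) - B x = NormedSpace.exp (s • B) (B x - y)
        + (NormedSpace.exp (s • B) y - y) - (B x - y) := by
      rw [map_sub]; abel
    have h1 := hB s hs.1 (B x - y)
    have h2 := hB.norm_sub_self_le hs.1 y
    have h3 : s * ‖B y‖ ≤ t * ‖B y‖ := by gcongr; exact hs.2.le
    rw [e]
    refine (_root_.norm_sub_le _ _).trans ?_
    have := norm_add_le (NormedSpace.exp (s • B) (B x - y)) (NormedSpace.exp (s • B) y - y)
    linarith
  have := norm_image_sub_le_of_norm_deriv_le_segment' (a := 0) (b := t)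
    (fun s _ => (hd s).hasDerivWithinAt) hb t ⟨ht, le_rfl⟩
  have e : NormedSpace.exp (t • B) x - x - t • B x
      = NormedSpace.exp (t • B) x - t • B x - (NormedSpace.exp ((0:ℝ) • B) x - (0:ℝ) • B x) := by
    simp; abel
  rw [e]
  linarith

end Exponential

/-- The squared norm of the orbit has derivative 2⟨B exp(sB)x, exp(sB)x⟩ ≤ 0. -/
lemma contractiveExp_of_dissipative {E : Type*} [NormedAddCommGroup E] [InnerProductSpace ℝ E]
    [CompleteSpace E] {B : E →L[ℝ] E} (h : ∀ x, inner ℝ (B x) x ≤ 0) : ContractiveExp B := by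
  intro t ht x
  have hd : ∀ s : ℝ, HasDerivAt (fun s : ℝ => ‖NormedSpace.exp (s • B) x‖ ^ 2)
      (2 * inner ℝ (NormedSpace.exp (s • B) x) (NormedSpace.exp (s • B) (B x))) s := fun s =>
    (hasDerivAt_exp_smul_apply B x s).norm_sq
  have hneg : ∀ s : ℝ,
      2 * inner ℝ (NormedSpace.exp (s • B) x) (NormedSpace.exp (s • B) (B x)) ≤ 0 := fun s => by
    have h3 : B (NormedSpace.exp (s • B) x) = NormedSpace.exp (s • B) (B x) :=
      congrArg (fun T : E →L[ℝ] E => T x) (commute_exp_smul (Commute.refl B) s).eq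
    rw [← h3, real_inner_comm]
    linarith [h (NormedSpace.exp (s • B) x)]
  have := antitone_of_hasDerivAt_nonpos hd hneg ht
  simp only [zero_smul, NormedSpace.exp_zero, one_apply_eq_self] at this
  exact (sq_le_sq₀ (norm_nonneg _) (norm_nonneg _)).1 this

/-! ### The Lumer–Phillips theorem -/

section LumerPhillips

variable {E : Type*} [NormedAddCommGroup E]

/-- Pair c x - y with x and apply Cauchy–Schwarz; this is the resolvent bound. -/
lemma norm_le_of_dissipative [InnerProductSpace ℝ E] {b c : ℝ} (hc : b < c) {x y : E}
    (h : inner ℝ y x ≤ b * ‖x‖ ^ 2) : ‖x‖ ≤ (c - b)⁻¹ * ‖c • x - y‖ := by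
  have h1 : inner ℝ (c • x - y) x = c * ‖x‖ ^ 2 - inner ℝ y x := by
    rw [inner_sub_left, inner_smul_left, real_inner_self_eq_norm_sq]; simp
  have h2 := real_inner_le_norm (c • x - y) x
  rw [inv_mul_eq_div, le_div_iff₀ (by linarith)]
  rcases (norm_nonneg x).eq_or_lt with h0 | h0
  · rw [← h0]; simp
  · refine le_of_mul_le_mul_right (a := ‖x‖) ?_ h0
    nlinarith

/-- A sequence of contractions that converges on a dense set converges everywhere. -/
lemma cauchySeq_of_dense [NormedSpace ℝ E] {V : ℕ → E →L[ℝ] E} (hV : ∀ n x, ‖V n x‖ ≤ ‖x‖)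
    {D : Set E} (hD : Dense D) (h : ∀ x ∈ D, CauchySeq fun n => V n x) (x : E) :
    CauchySeq fun n => V n x := by
  rw [Metric.cauchySeq_iff']
  intro ε hε
  obtain ⟨y, hy, hxy⟩ := hD.exists_dist_lt x (by positivity : 0 < ε / 4)
  obtain ⟨k, hk⟩ := Metric.cauchySeq_iff'.1 (h y hy) (ε / 4) (by positivity)
  refine ⟨k, fun n hn => ?_⟩
  have hVd : ∀ n, dist (V n x) (V n y) ≤ dist x y := fun n => by
    rw [dist_eq_norm, dist_eq_norm, ← map_sub]; exact hV n _
  have h1 := dist_triangle4 (V n x) (V n y) (V k y) (V k x)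
  have h2 := hVd n
  have h3 := hVd k
  rw [dist_comm] at h3
  have h4 := hk n hn
  linarith

/-- Contractions converging to the identity on a dense set converge to it everywhere. -/
lemma tendsto_self_of_dense [NormedSpace ℝ E] {ι : Type*} {F : Filter ι} {V : ι → E →L[ℝ] E}
    (hV : ∀ n x, ‖V n x‖ ≤ ‖x‖) {D : Set E} (hD : Dense D)
    (h : ∀ x ∈ D, Tendsto (fun n => V n x) F (𝓝 x)) (x : E) :
    Tendsto (fun n => V n x) F (𝓝 x) := by
  rw [Metric.tendsto_nhds]
  intro ε hε
  obtain ⟨y, hy, hxy⟩ := hD.exists_dist_lt x (by positivity : 0 < ε / 4)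
  filter_upwards [Metric.tendsto_nhds.1 (h y hy) (ε / 4) (by positivity)] with n hn
  have hVd : dist (V n x) (V n y) ≤ dist x y := by
    rw [dist_eq_norm, dist_eq_norm, ← map_sub]; exact hV n _
  have h1 := dist_triangle4 (V n x) (V n y) y x
  rw [dist_comm y x] at h1
  linarith

/-! ### Quasi-m-dissipative operators and their resolvents. -/

variable [InnerProductSpace ℝ E]

/-- `A - b` is dissipative, and `c - A` is onto for all `c > b`. -/
structure IsQuasiMDissipative (A : E →ₗ.[ℝ] E) (b : ℝ) : Prop where
  le : ∀ x : A.domain, inner ℝ (A x) (x : E) ≤ b * ‖(x : E)‖ ^ 2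
  surj : ∀ c : ℝ, b < c → ∀ y, ∃ x : A.domain, c • (x : E) - A x = y

variable {A : E →ₗ.[ℝ] E} {b : ℝ}

lemma IsQuasiMDissipative.norm_le (hA : IsQuasiMDissipative A b) {c : ℝ} (hc : b < c)
    (x : A.domain) : ‖(x : E)‖ ≤ (c - b)⁻¹ * ‖c • (x : E) - A x‖ :=
  norm_le_of_dissipative hc (hA.le x)

/-- If v is orthogonal to the domain, solve (b+1)x - Ax = v. Pairing with x gives (b+1)‖x‖² = ⟨Ax,
x⟩ ≤ b‖x‖², so x = 0 and v = 0. -/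
lemma IsQuasiMDissipative.dense [CompleteSpace E] (hA : IsQuasiMDissipative A b) :
    Dense (A.domain : Set E) := by
  rw [Submodule.dense_iff_topologicalClosure_eq_top, Submodule.topologicalClosure_eq_top_iff,
    Submodule.eq_bot_iff]
  intro v hv
  obtain ⟨x, hx⟩ := hA.surj (b + 1) (by linarith) v
  have h1 : inner ℝ v (x : E) = 0 := (Submodule.mem_orthogonal' _ _).1 hv x x.2
  rw [← hx, inner_sub_left, inner_smul_left, real_inner_self_eq_norm_sq] at h1
  have h2 := hA.le x
  simp only [conj_trivial] at h1
  have h3 : ‖(x : E)‖ ^ 2 ≤ 0 := by linarith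
  have h4 : (x : E) = 0 := norm_eq_zero.1 (by nlinarith [norm_nonneg (x : E)])
  have h5 : x = 0 := Subtype.ext h4
  rw [← hx, h5]
  simp

lemma IsQuasiMDissipative.exists_resolvent (hA : IsQuasiMDissipative A b) {c : ℝ} (hc : b < c) :
    ∃ R : E →L[ℝ] E, (∀ y, ‖R y‖ ≤ (c - b)⁻¹ * ‖y‖) ∧
      (∀ y, ∃ h : R y ∈ A.domain, c • R y - A ⟨R y, h⟩ = y) ∧
      ∀ x : A.domain, R (c • (x : E) - A x) = x := by
  let T : A.domain →ₗ[ℝ] E := c • A.domain.subtype - A.toFun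
  have hT : ∀ x, T x = c • (x : E) - A x := fun x => rfl
  have hinj : Function.Injective T := by
    rw [injective_iff_map_eq_zero]
    intro x hx
    have := hA.norm_le hc x
    rw [← hT, hx, norm_zero, mul_zero] at this
    exact Subtype.ext (norm_le_zero_iff.1 this)
  let e := LinearEquiv.ofBijective T ⟨hinj, fun y => hA.surj c hc y⟩
  have he : ∀ y, c • (e.symm y : E) - A (e.symm y) = y := fun y => e.apply_symm_apply y
  let R : E →L[ℝ] E := (A.domain.subtype ∘ₗ e.symm.toLinearMap).mkContinuous (c - b)⁻¹ (fun y => by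
    have := hA.norm_le hc (e.symm y)
    rwa [he] at this)
  refine ⟨R, fun y => ?_, fun y => ⟨(e.symm y).2, he y⟩, fun x => ?_⟩
  · have := hA.norm_le hc (e.symm y)
    rwa [he] at this
  · exact congrArg Subtype.val (e.symm_apply_apply x)

/-- A bounded perturbation of a quasi-m-dissipative operator is quasi-m-dissipative. -/
lemma IsQuasiMDissipative.add [CompleteSpace E] (hA : IsQuasiMDissipative A b) (B : E →L[ℝ] E)
    {A' : E →ₗ.[ℝ] E} (hdom : A'.domain = A.domain)
    (hval : ∀ (x : E) (h' : x ∈ A'.domain) (h : x ∈ A.domain), A' ⟨x, h'⟩ = A ⟨x, h⟩ + B x) :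
    IsQuasiMDissipative A' (b + ‖B‖) where
  le := by
    rintro ⟨x, hx⟩
    have hx' : x ∈ A.domain := hdom ▸ hx
    rw [hval x hx hx', inner_add_left]
    have h1 := hA.le ⟨x, hx'⟩
    have h2 := real_inner_le_norm (B x) x
    have h3 := mul_le_mul_of_nonneg_right (B.le_opNorm x) (norm_nonneg x)
    simp only at h1 ⊢
    nlinarith
  surj := by
    intro c hc y
    have hB := norm_nonneg B
    have hc' : b < c := by linarith
    obtain ⟨R, hR, hR1, -⟩ := hA.exists_resolvent hc'
    have hK : ‖(c - b)⁻¹ * ‖B‖‖ < 1 := by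
      have : 0 ≤ (c - b)⁻¹ := inv_nonneg.2 (by linarith)
      rw [Real.norm_of_nonneg (by positivity), inv_mul_eq_div, div_lt_one (by linarith)]
      linarith
    -- With R the resolvent of A at c, the equation cx - Ax - Bx = y is the fixed point equation x =
    -- R(y + Bx). It is contractive because c - b > ‖B‖.
    have hcon : ContractingWith ‖(c - b)⁻¹ * ‖B‖‖₊ (fun x => R (y + B x)) := by
      refine ⟨by exact_mod_cast hK, LipschitzWith.of_dist_le_mul fun u v => ?_⟩
      rw [dist_eq_norm, dist_eq_norm, ← map_sub, add_sub_add_left_eq_sub, ← map_sub]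
      have hn : 0 ≤ (c - b)⁻¹ := inv_nonneg.2 (by linarith)
      have e : ((‖(c - b)⁻¹ * ‖B‖‖₊ : ℝ≥0) : ℝ) = (c - b)⁻¹ * ‖B‖ := by
        rw [coe_nnnorm, Real.norm_of_nonneg (by positivity)]
      rw [e, mul_assoc]
      exact (hR _).trans (mul_le_mul_of_nonneg_left (B.le_opNorm _) hn)
    obtain ⟨x, hx, -⟩ := hcon.exists_fixedPoint 0 (edist_ne_top _ _)
    have hx : R (y + B x) = x := hx
    obtain ⟨h, he⟩ := hR1 (y + B x)
    simp only [hx] at h he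
    have h' : x ∈ A'.domain := hdom ▸ h
    refine ⟨⟨x, h'⟩, ?_⟩
    rw [hval x h' h]
    simp only
    rw [← sub_sub, he]
    abel

/-! ### Yosida approximations and the generated semigroup. -/

variable [CompleteSpace E]

/-- The approximations are Yₙ = cₙ(cₙRₙ - 1) with cₙ = n + 1 and Rₙ the resolvent at cₙ. On the
domain Yₙx = cₙRₙAx, where cₙRₙ is a contraction; it tends strongly to the identity because cₙRₙy -
y = RₙAy = O(1/cₙ) on the dense domain. -/
lemma IsQuasiMDissipative.exists_yosida (hA : IsQuasiMDissipative A 0) :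
    ∃ Y : ℕ → E →L[ℝ] E, (∀ n, ContractiveExp (Y n)) ∧ (∀ n m, Commute (Y n) (Y m)) ∧
      (∀ (n) (x : A.domain), ‖Y n x‖ ≤ ‖A x‖) ∧
      ∀ x : A.domain, Tendsto (fun n => Y n x) atTop (𝓝 (A x)) := by
  have hpos : ∀ n : ℕ, (0:ℝ) < n + 1 := fun n => by positivity
  choose R hR hR1 hR2 using fun n : ℕ => hA.exists_resolvent (hpos n)
  simp only [sub_zero] at hR
  set c : ℕ → ℝ := fun n => n + 1 with hcdef
  change ∀ n y, ‖R n y‖ ≤ (c n)⁻¹ * ‖y‖ at hR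
  have hc : ∀ n, 0 < c n := hpos
  have hcR : ∀ n y, ‖(c n • R n) y‖ ≤ ‖y‖ := fun n y => by
    have := mul_le_mul_of_nonneg_left (hR n y) (hc n).le
    rw [← mul_assoc, mul_inv_cancel₀ (hc n).ne', one_mul] at this
    rwa [smul_apply, norm_smul, Real.norm_of_nonneg (hc n).le]
  have key : ∀ n (x : A.domain), c n • R n x - x = R n (A x) := fun n x => by
    have := hR2 n x
    rw [map_sub, map_smul] at this
    change c n • R n x - R n (A x) = _ at this
    nth_rewrite 2 [← this]
    abel
  have hcomm : ∀ n m, Commute (R n) (R m) := by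
    intro n m
    rcases eq_or_ne n m with rfl | hnm
    · exact Commute.refl _
    -- The resolvent identity. Exchanging n and m in it gives commutation after division by cₙ - cₘ.
    have main : ∀ n m y, (c n - c m) • R n (R m y) = R m y - R n y := by
      intro n m y
      obtain ⟨h, he⟩ := hR1 m y
      have h1 := hR2 n ⟨R m y, h⟩
      have h2 : c n • R m y - A ⟨R m y, h⟩ = y + (c n - c m) • R m y := by
        nth_rewrite 3 [← he]
        rw [sub_smul]
        abel
      change R n (c n • R m y - A ⟨R m y, h⟩) = R m y at h1
      rw [h2, map_add, map_smul] at h1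
      nth_rewrite 2 [← h1]
      abel
    ext y
    have hne : c n - c m ≠ 0 := by
      simpa [c, sub_eq_zero] using hnm
    refine smul_right_injective E hne ?_
    have h1 := main n m y
    have h2 := main m n y
    rw [← neg_sub (c n), neg_smul] at h2
    simp only [ContinuousLinearMap.mul_def, ContinuousLinearMap.comp_apply]
    rw [h1, ← neg_neg ((c n - c m) • R m (R n y)), h2]
    abel
  let Y : ℕ → E →L[ℝ] E := fun n => c n • (c n • R n - 1)
  have hYA : ∀ n (x : A.domain), Y n x = (c n • R n) (A x) := fun n x => by
    simp [Y, ← key]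
  refine ⟨Y, fun n => contractiveExp_of_dissipative fun x => ?_, fun n m => ?_, fun n x => ?_,
    fun x => ?_⟩
  -- Yₙ is dissipative since ⟨cₙRₙx, x⟩ ≤ ‖x‖².
  · have h1 : inner ℝ (Y n x) x = c n * (inner ℝ ((c n • R n) x) x - ‖x‖ ^ 2) := by
      simp only [Y, smul_apply, sub_apply,
        inner_smul_left, inner_sub_left, one_apply_eq_self,
        real_inner_self_eq_norm_sq, conj_trivial]
    rw [h1]
    have h2 := real_inner_le_norm ((c n • R n) x) x
    have h3 := mul_le_mul_of_nonneg_right (hcR n x) (norm_nonneg x)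
    exact mul_nonpos_of_nonneg_of_nonpos (hc n).le (by nlinarith)
  · have : Commute (c n • R n - 1) (c m • R m - 1) :=
      Commute.sub_left (Commute.sub_right (((hcomm n m).smul_left _).smul_right _)
        (Commute.one_right _)) (Commute.one_left _)
    exact (this.smul_left _).smul_right _
  · rw [hYA]; exact hcR n _
  · simp only [hYA]
    refine tendsto_self_of_dense (V := fun n => c n • R n) hcR hA.dense (fun y hy => ?_) (A x)
    rw [tendsto_iff_norm_sub_tendsto_zero]
    have h0 : Tendsto (fun n => (c n)⁻¹ * ‖A ⟨y, hy⟩‖) atTop (𝓝 0) := by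
      have : Tendsto (fun n : ℕ => (c n)⁻¹) atTop (𝓝 0) := by
        simpa [c, one_div] using tendsto_one_div_add_atTop_nhds_zero_nat (𝕜 := ℝ)
      simpa using this.mul_const _
    refine squeeze_zero (fun _ => norm_nonneg _) (fun n => ?_) h0
    have := key n ⟨y, hy⟩
    simp only [smul_apply] at this ⊢
    rw [this]
    exact hR n _

/-- T(t) is the strong limit of exp(tYₙ). The sequence is Cauchy on the domain by
`ContractiveExp.norm_sub_le`, hence everywhere by contractivity, and the estimates for the
exponentials survive in the limit. -/
lemma IsQuasiMDissipative.exists_c0Semigroup_of_zero (hA : IsQuasiMDissipative A 0) :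
    ∃ S : C0Semigroup E, S.HasGenerator A := by
  obtain ⟨Y, hY, hcomm, hYA, hlim⟩ := hA.exists_yosida
  let V : ℝ≥0 → ℕ → E →L[ℝ] E := fun t n => NormedSpace.exp ((t : ℝ) • Y n)
  have hV : ∀ t n x, ‖V t n x‖ ≤ ‖x‖ := fun t n => hY n t t.2
  have hconv : ∀ t : ℝ≥0, ∃ U : E → E, ∀ x, Tendsto (fun n => V t n x) atTop (𝓝 (U x)) := by
    intro t
    have : ∀ x, ∃ y, Tendsto (fun n => V t n x) atTop (𝓝 y) := fun x => by
      refine cauchySeq_tendsto_of_complete (cauchySeq_of_dense (hV t) hA.dense (fun x hx => ?_) x)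
      have hc := (hlim ⟨x, hx⟩).cauchySeq
      rw [Metric.cauchySeq_iff] at hc ⊢
      intro ε hε
      -- Dividing by t + 1 rather than t covers t = 0.
      obtain ⟨k, hk⟩ := hc (ε / (t + 1)) (by positivity)
      refine ⟨k, fun m hm n hn => ?_⟩
      have h1 := hk m hm n hn
      rw [dist_eq_norm, lt_div_iff₀ (by positivity)] at h1
      rw [dist_eq_norm]
      refine ((hY m).norm_sub_le (hY n) (hcomm m n) t.2 x).trans_lt ?_
      have h2 := norm_nonneg (Y m x - Y n x)
      have h3 : (0:ℝ) ≤ t := t.2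
      simp only at h1
      change (t : ℝ) * _ < ε
      nlinarith
    choose U hU using this
    exact ⟨U, hU⟩
  choose U hU using hconv
  let T : ℝ≥0 → E →L[ℝ] E := fun t =>
    continuousLinearMapOfTendsto (V t) (tendsto_pi_nhds.2 (hU t))
  have hT : ∀ t x, Tendsto (fun n => V t n x) atTop (𝓝 (T t x)) := hU
  have hTn : ∀ t x, ‖T t x‖ ≤ ‖x‖ := fun t x =>
    le_of_tendsto (hT t x).norm (Eventually.of_forall fun n => hV t n x)
  have hTd : ∀ t (x : A.domain), ‖T t x - x‖ ≤ t * ‖A x‖ := fun t x =>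
    le_of_tendsto ((hT t x).sub_const _).norm (Eventually.of_forall fun n =>
      ((hY n).norm_sub_self_le t.2 x).trans (mul_le_mul_of_nonneg_left (hYA n x) t.2))
  have hTgen : ∀ (t : ℝ≥0) (x y : A.domain),
      ‖T t x - x - (t : ℝ) • A x‖ ≤ t * (2 * ‖A x - y‖ + t * ‖A y‖) := by
    intro t x y
    refine le_of_tendsto_of_tendsto
      (((hT t x).sub_const (x : E)).sub ((hlim x).const_smul (t : ℝ))).norm
      (((((hlim x).sub_const (y : E)).norm.const_mul 2).add_const (t * ‖A y‖)).const_mul (t : ℝ))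
      (Eventually.of_forall fun n => ?_)
    refine ((hY n).norm_sub_sub_le t.2 x y).trans ?_
    have := hYA n y
    have ht : (0 : ℝ) ≤ t := t.2
    refine mul_le_mul_of_nonneg_left ?_ ht
    have := mul_le_mul_of_nonneg_left this ht
    change 2 * ‖Y n x - y‖ + t * ‖Y n y‖ ≤ 2 * ‖Y n x - y‖ + t * ‖A y‖
    linarith
  let S : C0Semigroup E :=
    { T := T
      map_zero := by
        ext x
        refine tendsto_nhds_unique (hT 0 x) ?_
        simp [V]
      map_add := by
        intro s t
        ext x
        refine tendsto_nhds_unique (hT (s + t) x) ?_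
        -- Both factors of exp(sYₙ)exp(tYₙ)x vary with n; splitting off the error in the inner one
        -- leaves a term that the contraction exp(sYₙ) sends to 0.
        have e : ∀ n, V (s + t) n x = V s n (V t n x - T t x) + V s n (T t x) := fun n => by
          rw [← map_add, sub_add_cancel]
          simp only [V, NNReal.coe_add, exp_add_smul]
          rfl
        simp only [e]
        have h0 : Tendsto (fun n => V s n (V t n x - T t x)) atTop (𝓝 0) := by
          refine squeeze_zero_norm (fun n => hV s n _) ?_
          simpa using ((hT t x).sub_const (T t x)).norm
        simpa using h0.add (hT s (T t x))
      strong := fun x => tendsto_self_of_dense hTn hA.dense (fun y hy => by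
        rw [tendsto_iff_norm_sub_tendsto_zero]
        refine squeeze_zero (fun _ => norm_nonneg _) (fun t => hTd t ⟨y, hy⟩) ?_
        have h0 : Tendsto (fun t : ℝ≥0 => (t : ℝ)) (𝓝[>] 0) (𝓝 0) :=
          (NNReal.continuous_coe.tendsto' 0 0 rfl).mono_left nhdsWithin_le_nhds
        simpa using h0.mul_const ‖A ⟨y, hy⟩‖) x }
  have hpos : ∀ᶠ t : ℝ≥0 in 𝓝[>] 0, (0:ℝ) < t := by
    filter_upwards [self_mem_nhdsWithin] with t ht
    exact ht
  have hcoe : Tendsto (fun t : ℝ≥0 => (t : ℝ)) (𝓝[>] 0) (𝓝 0) :=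
    (NNReal.continuous_coe.tendsto' 0 0 rfl).mono_left nhdsWithin_le_nhds
  have hdom : ∀ x : A.domain,
      Tendsto (fun t : ℝ≥0 => (t : ℝ)⁻¹ • (T t x - x)) (𝓝[>] 0) (𝓝 (A x)) := by
    intro x
    rw [Metric.tendsto_nhds]
    intro ε hε
    -- Ax need not lie in the domain, so it is replaced by a nearby y that does; the error t‖Ay‖
    -- then vanishes with t.
    obtain ⟨y, hy, hxy⟩ := hA.dense.exists_dist_lt (A x) (by positivity : 0 < ε / 4)
    have h1 : ∀ᶠ t : ℝ≥0 in 𝓝[>] 0, (t : ℝ) * ‖A ⟨y, hy⟩‖ < ε / 2 :=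
      (by simpa using hcoe.mul_const ‖A ⟨y, hy⟩‖ :
        Tendsto (fun t : ℝ≥0 => (t : ℝ) * ‖A ⟨y, hy⟩‖) (𝓝[>] 0) (𝓝 0)).eventually_lt_const
        (by positivity)
    filter_upwards [h1, hpos] with t ht ht0
    have e : (t : ℝ)⁻¹ • (T t x - x) - A x = (t : ℝ)⁻¹ • (T t x - x - (t : ℝ) • A x) := by
      rw [smul_sub (t : ℝ)⁻¹ (T t x - x), smul_smul, inv_mul_cancel₀ ht0.ne', one_smul]
    rw [dist_eq_norm] at hxy ⊢
    rw [e, norm_smul, norm_inv, Real.norm_of_nonneg ht0.le]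
    have h2 := hTgen t x ⟨y, hy⟩
    rw [inv_mul_eq_div, div_lt_iff₀ ht0]
    simp only at h2
    nlinarith
  refine ⟨S, fun x y => ⟨?_, fun hxy => ?_⟩⟩
  · rintro ⟨hx, rfl⟩
    exact hdom ⟨x, hx⟩
  -- No larger domain is possible. With u - Au = x - y, the difference quotient of T at x - u tends
  -- to y - Au = x - u. By contractivity its pairing with x - u is nonpositive, so ‖x - u‖² ≤ 0.
  · obtain ⟨u, hu⟩ := hA.surj 1 one_pos (x - y)
    rw [one_smul] at hu
    have hw := hxy.sub (hdom u)
    have ew : y - A u = x - u := by rw [← sub_eq_zero, ← sub_eq_zero.2 hu]; abel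
    rw [ew] at hw
    have hin : ∀ᶠ t : ℝ≥0 in 𝓝[>] 0, inner ℝ ((t : ℝ)⁻¹ • (T t x - x) - (t : ℝ)⁻¹ • (T t u - u))
        (x - u) ≤ 0 := by
      filter_upwards [hpos] with t ht
      have e : (t : ℝ)⁻¹ • (T t x - x) - (t : ℝ)⁻¹ • (T t u - u)
          = (t : ℝ)⁻¹ • (T t (x - u) - (x - u)) := by
        rw [← smul_sub, map_sub]; congr 1; abel
      rw [e, inner_smul_left, inner_sub_left, real_inner_self_eq_norm_sq]
      have h1 := real_inner_le_norm (T t (x - u)) (x - u)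
      have h2 := mul_le_mul_of_nonneg_right (hTn t (x - u)) (norm_nonneg (x - u))
      exact mul_nonpos_of_nonneg_of_nonpos (by simp) (by nlinarith)
    have h0 := le_of_tendsto (hw.inner (tendsto_const_nhds (x := x - (u : E)))) hin
    rw [real_inner_self_eq_norm_sq] at h0
    have h1 : x - (u : E) = 0 := norm_eq_zero.1 (by nlinarith [norm_nonneg (x - (u : E))])
    have hxu : x = u := sub_eq_zero.1 h1
    refine ⟨hxu ▸ u.2, ?_⟩
    have e2 : A ⟨x, hxu ▸ u.2⟩ = A u := by congr 1; exact Subtype.ext hxu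
    rw [e2]
    exact (sub_eq_zero.1 (ew.trans h1)).symm

/-- The semigroup `exp (b t) T(t)`. -/
def C0Semigroup.shift {F : Type*} [NormedAddCommGroup F] [NormedSpace ℝ F] (S : C0Semigroup F)
    (b : ℝ) : C0Semigroup F where
  T t := Real.exp (b * t) • S.T t
  map_zero := by simp [S.map_zero]
  map_add s t := by
    ext x
    simp [S.map_add, mul_add, Real.exp_add, smul_smul, mul_comm]
  strong x := by
    have h0 : Tendsto (fun t : ℝ≥0 => Real.exp (b * t)) (𝓝[>] 0) (𝓝 1) := by
      refine Tendsto.mono_left ?_ nhdsWithin_le_nhds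
      exact Continuous.tendsto' (by fun_prop) _ _ (by simp)
    simpa using h0.smul (S.strong x)

/-- Product rule: exp(bt)T(t)x - x = exp(bt)(T(t)x - x) + (exp(bt) - 1)x, divided by t. -/
lemma C0Semigroup.tendsto_shift {F : Type*} [NormedAddCommGroup F] [NormedSpace ℝ F]
    (S : C0Semigroup F) (b : ℝ) {x y : F}
    (h : Tendsto (fun t : ℝ≥0 => (t : ℝ)⁻¹ • (S.T t x - x)) (𝓝[>] 0) (𝓝 y)) :
    Tendsto (fun t : ℝ≥0 => (t : ℝ)⁻¹ • ((S.shift b).T t x - x)) (𝓝[>] 0) (𝓝 (y + b • x)) := by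
  have h0 : Tendsto (fun t : ℝ≥0 => Real.exp (b * t)) (𝓝[>] 0) (𝓝 1) := by
    refine Tendsto.mono_left ?_ nhdsWithin_le_nhds
    exact Continuous.tendsto' (by fun_prop) _ _ (by simp)
  have hd : HasDerivAt (fun t : ℝ => Real.exp (b * t)) b 0 := by
    simpa using ((hasDerivAt_id (0:ℝ)).const_mul b).exp
  have hcoe : Tendsto (fun t : ℝ≥0 => (t : ℝ)) (𝓝[>] 0) (𝓝[≠] 0) := by
    refine tendsto_nhdsWithin_iff.2
      ⟨(NNReal.continuous_coe.tendsto' 0 0 rfl).mono_left nhdsWithin_le_nhds, ?_⟩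
    filter_upwards [self_mem_nhdsWithin] with t ht
    exact NNReal.coe_ne_zero.2 (ne_of_gt ht)
  have h1 : Tendsto (fun t : ℝ≥0 => (t : ℝ)⁻¹ * (Real.exp (b * t) - 1)) (𝓝[>] 0) (𝓝 b) := by
    have := (hasDerivAt_iff_tendsto_slope.1 hd).comp hcoe
    refine this.congr fun t => ?_
    simp [slope_def_field, div_eq_inv_mul]
  have := (h0.smul h).add (h1.smul_const x)
  rw [one_smul] at this
  refine this.congr fun t => ?_
  simp only [C0Semigroup.shift, smul_apply, smul_sub, sub_smul, smul_smul, mul_sub, mul_one,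
    mul_comm (Real.exp (b * t))]
  abel

/-- **Lumer–Phillips theorem** in a Hilbert space. -/
theorem IsQuasiMDissipative.exists_c0Semigroup {b : ℝ} (hA : IsQuasiMDissipative A b) :
    ∃ S : C0Semigroup E, S.HasGenerator A := by
  let A' : E →ₗ.[ℝ] E := ⟨A.domain, A.toFun - b • A.domain.subtype⟩
  have hA'v : ∀ x : A.domain, A' x = A x - b • (x : E) := fun x => rfl
  have hA' : IsQuasiMDissipative A' 0 := by
    refine ⟨fun x => ?_, fun c hc y => ?_⟩
    · rw [hA'v, inner_sub_left, inner_smul_left, real_inner_self_eq_norm_sq]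
      have := hA.le x
      simp only [conj_trivial]
      linarith
    · obtain ⟨x, hx⟩ := hA.surj (b + c) (by linarith) y
      refine ⟨x, ?_⟩
      rw [hA'v, ← hx, add_smul]
      abel
  obtain ⟨S, hS⟩ := hA'.exists_c0Semigroup_of_zero
  refine ⟨S.shift b, fun x y => ⟨?_, fun h => ?_⟩⟩
  · rintro ⟨hx, rfl⟩
    have := S.tendsto_shift b ((hS x _).1 ⟨hx, rfl⟩)
    rwa [hA'v, sub_add_cancel] at this
  -- Shifting back by -b recovers S, whose generator is A - b.
  · have h1 := (S.shift b).tendsto_shift (-b) h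
    have e : ∀ t, ((S.shift b).shift (-b)).T t x = S.T t x := fun t => by
      simp [C0Semigroup.shift, smul_smul, ← Real.exp_add]
    simp only [e] at h1
    obtain ⟨hx, hy⟩ := (hS x _).2 h1
    refine ⟨hx, ?_⟩
    rw [hA'v, neg_smul, ← sub_eq_add_neg] at hy
    exact sub_left_injective hy

/-- The operator `e ∘ G ∘ e⁻¹`. -/
def conjPMap {F : Type*} [AddCommGroup F] [Module ℝ F] (e : F ≃ₗ[ℝ] E)
    (G : F →ₗ.[ℝ] F) : E →ₗ.[ℝ] E where
  domain := G.domain.comap e.symm.toLinearMap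
  toFun := e.toLinearMap ∘ₗ G.toFun ∘ₗ
    e.symm.toLinearMap.restrict (p := G.domain.comap e.symm.toLinearMap) fun _ h => h

/-- Generation transfers along an isomorphism of normed spaces. -/
theorem IsQuasiMDissipative.exists_c0Semigroup_of_equiv {F : Type*} [NormedAddCommGroup F]
    [NormedSpace ℝ F] (e : F ≃L[ℝ] E) {G : F →ₗ.[ℝ] F} {b : ℝ}
    (hG : IsQuasiMDissipative (conjPMap e.toLinearEquiv G) b) :
    ∃ S : C0Semigroup F, S.HasGenerator G := by
  obtain ⟨S, hS⟩ := hG.exists_c0Semigroup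
  refine ⟨⟨fun t => (e.symm : E →L[ℝ] F) ∘L S.T t ∘L (e : F →L[ℝ] E), ?_, ?_, ?_⟩, ?_⟩
  · ext x; simp [S.map_zero]
  · intro s t; ext x; simp [S.map_add]
  · intro x
    have := (e.symm.continuous.tendsto _).comp (S.strong (e x))
    rw [e.symm_apply_apply] at this
    exact this
  · intro x y
    have h1 : (∃ hx : x ∈ G.domain, G ⟨x, hx⟩ = y) ↔
        ∃ hx : e x ∈ (conjPMap e.toLinearEquiv G).domain,
          conjPMap e.toLinearEquiv G ⟨e x, hx⟩ = e y := by
      have hd : e x ∈ (conjPMap e.toLinearEquiv G).domain ↔ x ∈ G.domain := by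
        change e.symm (e x) ∈ G.domain ↔ _
        rw [e.symm_apply_apply]
      refine ⟨fun ⟨hx, hy⟩ => ⟨hd.2 hx, ?_⟩, fun ⟨hx, hy⟩ => ⟨hd.1 hx, ?_⟩⟩
      · rw [← hy]
        change e (G ⟨e.symm (e x), _⟩) = _
        congr 3
        exact e.symm_apply_apply x
      · have : e (G ⟨e.symm (e x), hx⟩) = e y := hy
        rw [← e.injective this]
        congr 2
        exact (e.symm_apply_apply x).symm
    rw [h1, hS]
    refine ⟨fun h => ?_, fun h => ?_⟩
    · have := (e.symm.continuous.tendsto _).comp h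
      rw [e.symm_apply_apply] at this
      refine this.congr fun t => ?_
      simp
    · have := (e.continuous.tendsto _).comp h
      refine this.congr fun t => ?_
      simp

end LumerPhillips

/-! ### The Volterra operator -/

section Volterra

variable {l : ℝ}

/-- The constant function `1` in `L²(0, l)`. -/
def one (l : ℝ) : L2 l := indicatorConstLp 2 MeasurableSet.univ (measure_ne_top (mu l) _) 1

lemma one_ae : one l =ᵐ[mu l] fun _ => 1 := by
  filter_upwards [indicatorConstLp_coeFn (p := 2) (hs := MeasurableSet.univ)
    (hμs := measure_ne_top (mu l) _) (c := (1:ℝ))] with x hx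
  simpa [one] using hx

lemma inner_eq_integral (u v : L2 l) : inner ℝ u v = ∫ y, u y * v y ∂(mu l) := by
  rw [L2.inner_def]
  simp [mul_comm]

lemma integrable_mul_self (u : L2 l) : Integrable (fun y => u y * u y) (mu l) := by
  simpa [pow_two] using L2.integrable_inner (𝕜 := ℝ) u u

lemma inner_one (u : L2 l) : inner ℝ (one l) u = ∫ y, u y ∂(mu l) := by
  rw [one, L2.inner_indicatorConstLp_one, setIntegral_univ]

/-- The primitive of `u` that vanishes at `0`. -/
def prim (u : L2 l) (x : ℝ) : ℝ := ∫ t in (0:ℝ)..x, u t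

lemma intervalIntegrable_coe (hl : 0 < l) (u : L2 l) : IntervalIntegrable u volume 0 l := by
  rw [intervalIntegrable_iff_integrableOn_Ioo_of_le hl.le]
  exact u.integrable

/-- Writing the primitive as a pairing with an indicator gives linearity for free and the √l bound
from Cauchy–Schwarz. -/
lemma prim_eq_inner (u : L2 l) {x : ℝ} (hx : x ∈ Icc 0 l) :
    prim u x = inner ℝ (indicatorConstLp 2 (measurableSet_Ioo (a := 0) (b := x))
      (measure_ne_top (mu l) _) (1:ℝ)) u := by
  rw [L2.inner_indicatorConstLp_one, prim, intervalIntegral.integral_of_le hx.1,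
    integral_Ioc_eq_integral_Ioo, Measure.restrict_restrict measurableSet_Ioo,
    inter_eq_self_of_subset_left (Ioo_subset_Ioo_right hx.2)]

lemma prim_add (u v : L2 l) {x : ℝ} (hx : x ∈ Icc 0 l) : prim (u + v) x = prim u x + prim v x := by
  simp only [prim_eq_inner _ hx, inner_add_right]

lemma prim_smul (c : ℝ) (u : L2 l) {x : ℝ} (hx : x ∈ Icc 0 l) :
    prim (c • u) x = c * prim u x := by
  simp only [prim_eq_inner _ hx, inner_smul_right]

lemma abs_prim_le (u : L2 l) {x : ℝ} (hx : x ∈ Icc 0 l) : |prim u x| ≤ √l * ‖u‖ := by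
  rw [prim_eq_inner u hx]
  refine (abs_real_inner_le_norm _ _).trans (mul_le_mul_of_nonneg_right ?_ (norm_nonneg _))
  rw [norm_indicatorConstLp (by simp) (by simp), norm_one, one_mul, Real.sqrt_eq_rpow]
  simp only [ENNReal.toReal_ofNat]
  refine Real.rpow_le_rpow measureReal_nonneg ?_ (by norm_num)
  rw [measureReal_restrict_apply measurableSet_Ioo,
    inter_eq_self_of_subset_left (Ioo_subset_Ioo_right hx.2), Real.volume_real_Ioo_of_le hx.1]
  linarith [hx.2]

lemma absolutelyContinuousOnInterval_prim (hl : 0 < l) (u : L2 l) :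
    AbsolutelyContinuousOnInterval (prim u) 0 l :=
  (intervalIntegrable_coe hl u).absolutelyContinuousOnInterval_intervalIntegral (by simp)

lemma deriv_prim_ae (hl : 0 < l) (u : L2 l) : ∀ᵐ x ∂(mu l), HasDerivAt (prim u) (u x) x := by
  rw [ae_restrict_iff' measurableSet_Ioo]
  filter_upwards [(intervalIntegrable_coe hl u).ae_hasDerivAt_integral] with x hx hx'
  exact hx (by rw [uIcc_of_le hl.le]; exact Ioo_subset_Icc_self hx') 0 (by simp)

lemma aestronglyMeasurable_prim (hl : 0 < l) (u : L2 l) : AEStronglyMeasurable (prim u) (mu l) := by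
  have h := (absolutelyContinuousOnInterval_prim hl u).continuousOn
  rw [uIcc_of_le hl.le] at h
  exact (h.mono Ioo_subset_Icc_self).aestronglyMeasurable measurableSet_Ioo

lemma memLp_prim (hl : 0 < l) (u : L2 l) : MemLp (prim u) 2 (mu l) := by
  refine MemLp.of_bound (aestronglyMeasurable_prim hl u) (√l * ‖u‖) ?_
  filter_upwards [ae_restrict_mem measurableSet_Ioo] with x hx
  exact abs_prim_le u (Ioo_subset_Icc_self hx)

/-- The Volterra operator `(J u)(x) = ∫₀ˣ u`. -/
def J (hl : 0 < l) : L2 l →L[ℝ] L2 l :=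
  LinearMap.mkContinuous
    { toFun := fun u => (memLp_prim hl u).toLp (prim u)
      map_add' := fun u v => by
        refine Lp.ext ?_
        filter_upwards [(memLp_prim hl (u + v)).coeFn_toLp, (memLp_prim hl u).coeFn_toLp,
          (memLp_prim hl v).coeFn_toLp, Lp.coeFn_add ((memLp_prim hl u).toLp (prim u))
            ((memLp_prim hl v).toLp (prim v)), ae_restrict_mem measurableSet_Ioo]
          with x h1 h2 h3 h4 hx
        rw [h1, h4, Pi.add_apply, h2, h3, prim_add u v (Ioo_subset_Icc_self hx)]
      map_smul' := fun c u => by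
        refine Lp.ext ?_
        filter_upwards [(memLp_prim hl (c • u)).coeFn_toLp, (memLp_prim hl u).coeFn_toLp,
          Lp.coeFn_smul c ((memLp_prim hl u).toLp (prim u)), ae_restrict_mem measurableSet_Ioo]
          with x h1 h2 h3 hx
        rw [h1, RingHom.id_apply, h3, Pi.smul_apply, h2, prim_smul c u (Ioo_subset_Icc_self hx),
          smul_eq_mul] }
    ((measureUnivNNReal (mu l) : ℝ) ^ (2:ℝ≥0∞).toReal⁻¹ * √l) (fun u => by
      rw [mul_assoc]
      refine Lp.norm_le_of_ae_bound (by positivity) ?_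
      filter_upwards [(memLp_prim hl u).coeFn_toLp, ae_restrict_mem measurableSet_Ioo] with x h1 hx
      refine le_trans (le_of_eq ?_) (abs_prim_le u (Ioo_subset_Icc_self hx))
      exact congrArg _ h1)

/-! ### Weak derivatives, endpoint values and Wirtinger's inequality. -/

variable (hl : 0 < l)
include hl

lemma J_ae (u : L2 l) : J hl u =ᵐ[mu l] prim u := (memLp_prim hl u).coeFn_toLp

lemma isACRep_J (u : L2 l) : IsACRep (J hl u) (prim u) :=
  ⟨absolutelyContinuousOnInterval_prim hl u, J_ae hl u⟩

/-- Integration by parts against an absolutely continuous function. -/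
lemma integral_prim_mul_deriv (u : L2 l) {g : ℝ → ℝ} (hg : AbsolutelyContinuousOnInterval g 0 l) :
    ∫ y, prim u y * deriv g y ∂(mu l) = prim u l * g l - ∫ y, u y * g y ∂(mu l) := by
  have e := (absolutelyContinuousOnInterval_prim hl u).integral_mul_deriv_eq_deriv_mul hg
  rw [intervalInt_eq hl, intervalInt_eq hl] at e
  have e2 : ∫ y, deriv (prim u) y * g y ∂(mu l) = ∫ y, u y * g y ∂(mu l) := by
    refine integral_congr_ae ?_
    filter_upwards [deriv_prim_ae hl u] with x hx
    rw [hx.deriv]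
  rw [e, e2]
  simp [prim]

omit hl in
lemma IsTest.absolutelyContinuousOnInterval {φ : ℝ → ℝ} (hφ : IsTest l φ) :
    AbsolutelyContinuousOnInterval φ 0 l :=
  ContDiffOn.absolutelyContinuousOnInterval (hφ.smooth.of_le (by simp)).contDiffOn

omit hl in
lemma IsTest.right {φ : ℝ → ℝ} (hφ : IsTest l φ) : φ l = 0 :=
  image_eq_zero_of_notMem_tsupport fun h => lt_irrefl _ (hφ.subset h).2

omit hl in
lemma IsTest.left {φ : ℝ → ℝ} (hφ : IsTest l φ) : φ 0 = 0 :=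
  image_eq_zero_of_notMem_tsupport fun h => lt_irrefl _ (hφ.subset h).1

lemma isWeakDeriv_J (u : L2 l) : IsWeakDeriv (J hl u) u := by
  intro φ hφ
  have e : ∫ y, J hl u y * deriv φ y ∂(mu l) = ∫ y, prim u y * deriv φ y ∂(mu l) := by
    refine integral_congr_ae ?_
    filter_upwards [J_ae hl u] with x hx
    rw [hx]
  rw [e, integral_prim_mul_deriv hl u hφ.absolutelyContinuousOnInterval, hφ.right]
  simp

lemma J_mem_H1 (u : L2 l) : J hl u ∈ H1 l := ⟨u, isWeakDeriv_J hl u⟩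

@[simp] lemma wd_J (u : L2 l) : wd (J hl u) = u := (isWeakDeriv_J hl u).wd_eq

lemma val_J_left (u : L2 l) : val (J hl u) 0 = 0 := by
  rw [(isACRep_J hl u).val_eq hl (left_mem_Icc.2 hl.le)]
  simp [prim]

lemma prim_right (u : L2 l) : prim u l = inner ℝ (one l) u := by
  rw [inner_one, prim, intervalInt_eq hl]

lemma val_J_right (u : L2 l) : val (J hl u) l = inner ℝ (one l) u := by
  rw [(isACRep_J hl u).val_eq hl (right_mem_Icc.2 hl.le), prim_right hl]

omit hl in
lemma isACRep_one : IsACRep (one l) (fun _ => 1) :=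
  ⟨ContDiffOn.absolutelyContinuousOnInterval contDiffOn_const, one_ae⟩

lemma isWeakDeriv_one : IsWeakDeriv (one l) 0 := by
  intro φ hφ
  have e : ∫ y, one l y * deriv φ y ∂(mu l) = ∫ y, deriv φ y ∂(mu l) := by
    refine integral_congr_ae ?_
    filter_upwards [one_ae (l := l)] with x hx
    rw [hx, one_mul]
  have e2 : ∫ y, (0 : L2 l) y * φ y ∂(mu l) = 0 := by
    rw [← integral_zero ℝ ℝ (μ := mu l)]
    refine integral_congr_ae ?_
    filter_upwards [Lp.coeFn_zero ℝ 2 (mu l)] with x hx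
    rw [hx, Pi.zero_apply, zero_mul]
  rw [e, e2, ← intervalInt_eq hl, hφ.absolutelyContinuousOnInterval.integral_deriv_eq_sub,
    hφ.left, hφ.right]
  simp

lemma one_mem_H1 : one l ∈ H1 l := ⟨0, isWeakDeriv_one hl⟩

lemma wd_one : wd (one l) = 0 := (isWeakDeriv_one hl).wd_eq

lemma val_one {x : ℝ} (hx : x ∈ Icc 0 l) : val (one l) x = 1 := isACRep_one.val_eq hl hx

/-- An element of `H¹(0, l)` is the primitive of its weak derivative. -/
lemma eq_val_left_add_J {u : L2 l} (hu : u ∈ H1 l) : u = val u 0 • one l + J hl (wd u) := by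
  obtain ⟨g, hg⟩ := exists_isACRep hl hu
  have hgi : IntervalIntegrable (deriv g) volume 0 l := hg.1.intervalIntegrable_deriv
  have hgi' : Integrable (deriv g) (mu l) := by
    rwa [intervalIntegrable_iff_integrableOn_Ioo_of_le hl.le] at hgi
  -- The classical and the weak derivative agree, since both satisfy integration by parts against
  -- all test functions.
  have hd : deriv g =ᵐ[mu l] wd u := by
    have := ae_zero_of_test (hgi'.sub (wd u).integrable) fun φ hφ => by
      have e := hg.1.integral_mul_deriv_eq_deriv_mul hφ.absolutelyContinuousOnInterval
      rw [hφ.left, hφ.right, intervalInt_eq hl, intervalInt_eq hl] at e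
      have e2 := isWeakDeriv_wd hu φ hφ
      have e3 : ∫ y, u y * deriv φ y ∂(mu l) = ∫ y, g y * deriv φ y ∂(mu l) := by
        refine integral_congr_ae ?_
        filter_upwards [hg.2] with x hx
        rw [hx]
      simp only [Pi.sub_apply, sub_mul]
      rw [integral_sub (integrable_mul_of_continuous hgi' hφ.continuous)
        (integrable_mul_of_continuous (wd u).integrable hφ.continuous)]
      linarith
    filter_upwards [this] with x hx
    exact sub_eq_zero.1 hx
  have hgx : ∀ x ∈ Icc 0 l, g x = g 0 + prim (wd u) x := by
    intro x hx
    have hac : AbsolutelyContinuousOnInterval g 0 x :=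
      hg.1.mono (by rw [uIcc_of_le hx.1, uIcc_of_le hl.le]; exact Icc_subset_Icc_right hx.2)
    have e : prim (wd u) x = ∫ y in (0:ℝ)..x, deriv g y := by
      rw [prim, intervalIntegral.integral_of_le hx.1, intervalIntegral.integral_of_le hx.1,
        integral_Ioc_eq_integral_Ioo, integral_Ioc_eq_integral_Ioo]
      exact integral_congr_ae
        (ae_restrict_of_ae_restrict_of_subset (Ioo_subset_Ioo_right hx.2) hd.symm)
    rw [e, hac.integral_deriv_eq_sub]
    ring
  rw [hg.val_eq hl (left_mem_Icc.2 hl.le)]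
  refine Lp.ext ?_
  filter_upwards [hg.2, J_ae hl (wd u), Lp.coeFn_add (g 0 • one l) (J hl (wd u)),
    Lp.coeFn_smul (g 0) (one l), one_ae (l := l), ae_restrict_mem measurableSet_Ioo]
    with x h1 h2 h3 h4 h5 hx
  rw [h1, h3, Pi.add_apply, h2, h4, Pi.smul_apply, h5, hgx x (Ioo_subset_Icc_self hx)]
  simp

lemma val_right {u : L2 l} (hu : u ∈ H1 l) : val u l = val u 0 + inner ℝ (one l) (wd u) := by
  have hr := right_mem_Icc.2 hl.le
  conv_lhs => rw [eq_val_left_add_J hl hu]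
  rw [val_add hl (Submodule.smul_mem _ _ (one_mem_H1 hl)) (J_mem_H1 hl _) hr,
    val_smul hl _ (one_mem_H1 hl) hr, val_one hl hr, val_J_right hl, mul_one]

/-- Integrate the derivative of the product of the two primitives, which vanishes at 0. -/
lemma inner_J_add (p q : L2 l) :
    inner ℝ (J hl p) q + inner ℝ p (J hl q) = inner ℝ (one l) p * inner ℝ (one l) q := by
  have e := integral_prim_mul_deriv hl p (absolutelyContinuousOnInterval_prim hl q)
  have e1 : ∫ y, prim p y * deriv (prim q) y ∂(mu l) = inner ℝ (J hl p) q := by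
    rw [inner_eq_integral]
    refine integral_congr_ae ?_
    filter_upwards [deriv_prim_ae hl q, J_ae hl p] with x hx h2
    rw [hx.deriv, h2]
  have e2 : ∫ y, p y * prim q y ∂(mu l) = inner ℝ p (J hl q) := by
    rw [inner_eq_integral]
    refine integral_congr_ae ?_
    filter_upwards [J_ae hl q] with x h2
    rw [h2]
  rw [e1, e2, prim_right hl, prim_right hl] at e
  linarith

/-- The adjoint `∫ₓˡ u` of the Volterra operator. -/
lemma adjoint_J (q : L2 l) :
    (J hl).adjoint q = inner ℝ (one l) q • one l - J hl q := by
  refine ext_inner_left ℝ fun p => ?_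
  rw [ContinuousLinearMap.adjoint_inner_right, inner_sub_right, inner_smul_right,
    real_inner_comm (one l) p, ← sub_eq_zero]
  linarith [inner_J_add hl p q]

/-- The fundamental theorem of calculus based at l, which is where the moment and torque conditions
are imposed. -/
lemma eq_val_right_sub {u : L2 l} (hu : u ∈ H1 l) :
    u = val u l • one l - (J hl).adjoint (wd u) := by
  nth_rewrite 1 [adjoint_J, val_right hl hu, eq_val_left_add_J hl hu]
  module

lemma adjoint_J_mem (q : L2 l) : (J hl).adjoint q ∈ H1 l := by
  rw [adjoint_J]
  exact sub_mem (Submodule.smul_mem _ _ (one_mem_H1 hl)) (J_mem_H1 hl q)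

lemma wd_add_adjoint_J (c : ℝ) (q : L2 l) :
    wd (c • one l + (J hl).adjoint q) = -q := by
  have e : c • one l + (J hl).adjoint q = (c + inner ℝ (one l) q) • one l + (-1 : ℝ) • J hl q := by
    rw [adjoint_J]; module
  rw [e, wd_add (Submodule.smul_mem _ _ (one_mem_H1 hl)) (Submodule.smul_mem _ _ (J_mem_H1 hl q)),
    wd_smul _ (one_mem_H1 hl), wd_smul _ (J_mem_H1 hl q), wd_one hl, wd_J]
  simp

lemma val_adjoint_J (q : L2 l) : val ((J hl).adjoint q) l = 0 := by
  have hr := right_mem_Icc.2 hl.le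
  rw [adjoint_J, sub_eq_add_neg, ← neg_one_smul ℝ,
    val_add hl (Submodule.smul_mem _ _ (one_mem_H1 hl)) (Submodule.smul_mem _ _ (J_mem_H1 hl q)) hr,
    val_smul hl _ (one_mem_H1 hl) hr, val_smul hl _ (J_mem_H1 hl q) hr, val_one hl hr, val_J_right hl]
  ring

/-- Wirtinger's inequality for functions vanishing at `0`, up to the sharp constant. -/
lemma wirtinger_of_lt (p : L2 l) {k : ℝ} (hk : 0 ≤ k) (hkl : k * l < Real.pi / 2) :
    k ^ 2 * ‖J hl p‖ ^ 2 ≤ ‖p‖ ^ 2 := by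
  -- c solves the Riccati equation c' = -k² - c² with c(l) = 0 and is finite on [0, l] because kl <
  -- π/2. For w = Jp, completing the square gives (c w²)' = p² - k²w² - (p - c w)².
  set c : ℝ → ℝ := fun x => k * Real.tan (k * (l - x)) with hc
  have hcos : ∀ x ∈ Icc 0 l, Real.cos (k * (l - x)) ≠ 0 := fun x hx => by
    have h1 : 0 ≤ k * (l - x) := mul_nonneg hk (by linarith [hx.2])
    have h2 : k * (l - x) ≤ k * l := mul_le_mul_of_nonneg_left (by linarith [hx.1]) hk
    exact (Real.cos_pos_of_mem_Ioo ⟨by linarith [Real.pi_pos], by linarith⟩).ne'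
  have hcd : ContDiffOn ℝ 1 c (uIcc 0 l) := by
    rw [uIcc_of_le hl.le]
    intro x hx
    refine ContDiffAt.contDiffWithinAt ?_
    have h1 : ContDiffAt ℝ 1 (fun x => k * (l - x)) x := by fun_prop
    exact contDiffAt_const.mul (ContDiffAt.comp (g := Real.tan) x
      (Real.contDiffAt_tan.2 (hcos x hx)) h1)
  have hc' : ∀ x ∈ Icc 0 l, HasDerivAt c (-k ^ 2 - c x ^ 2) x := fun x hx => by
    have h1 := (Real.hasDerivAt_tan (hcos x hx)).comp x
      (((hasDerivAt_id x).const_sub l).const_mul k) |>.const_mul k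
    refine h1.congr_deriv ?_
    simp only [hc, Real.tan_eq_sin_div_cos]
    have h2 := hcos x hx
    field_simp
    have := Real.sin_sq_add_cos_sq (k * (l - x))
    linear_combination (k ^ 2) * this
  have hw := absolutelyContinuousOnInterval_prim hl p
  have hh := (hcd.absolutelyContinuousOnInterval).mul (hw.mul hw)
  have h0 := hh.integral_deriv_eq_sub
  have hi := hh.intervalIntegrable_deriv
  rw [intervalIntegrable_iff_integrableOn_Ioo_of_le hl.le] at hi
  rw [intervalInt_eq hl] at h0
  -- The boundary terms vanish: c(l) = 0 on the right, the primitive is 0 on the left.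
  have hR : (c * (prim p * prim p)) l - (c * (prim p * prim p)) 0 = 0 := by
    simp [hc, prim]
  rw [hR] at h0
  have e1 : ∫ y, (p y * p y - k ^ 2 * (J hl p y * J hl p y)) ∂(mu l)
      = ‖p‖ ^ 2 - k ^ 2 * ‖J hl p‖ ^ 2 := by
    have i1 : ∀ u : L2 l, Integrable (fun y => u y * u y) (mu l) := fun u => integrable_mul_self u
    rw [integral_sub (i1 p) ((i1 _).const_mul _), integral_const_mul, ← inner_eq_integral,
      ← inner_eq_integral, real_inner_self_eq_norm_sq, real_inner_self_eq_norm_sq]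
  have hmono : ∫ y, deriv (c * (prim p * prim p)) y ∂(mu l)
      ≤ ∫ y, (p y * p y - k ^ 2 * (J hl p y * J hl p y)) ∂(mu l) := by
    have i1 : ∀ u : L2 l, Integrable (fun y => u y * u y) (mu l) := fun u => integrable_mul_self u
    refine integral_mono_ae hi ((i1 p).sub ((i1 _).const_mul _)) ?_
    filter_upwards [deriv_prim_ae hl p, J_ae hl p, ae_restrict_mem measurableSet_Ioo]
      with x h1 h2 hx
    have hd := (hc' x (Ioo_subset_Icc_self hx)).mul (h1.mul h1)
    rw [hd.deriv, h2]
    simp only [Pi.mul_apply]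
    nlinarith [sq_nonneg (p x - c x * prim p x)]
  rw [h0, e1] at hmono
  linarith

/-- Wirtinger's inequality for functions vanishing at `0`. -/
lemma norm_J_le (p : L2 l) : ‖J hl p‖ ≤ 2 * l / Real.pi * ‖p‖ := by
  have hpi := Real.pi_pos
  by_contra! h
  have hJ : 0 < ‖J hl p‖ := lt_of_le_of_lt (by positivity) h
  have h1 : ‖p‖ / ‖J hl p‖ < Real.pi / (2 * l) := by
    rw [div_lt_div_iff₀ hJ (by positivity)]
    rw [div_mul_eq_mul_div, div_lt_iff₀ hpi] at h
    linarith
  -- If the inequality failed, some k below π/(2l) would already violate the subcritical version.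
  obtain ⟨k, hk1, hk2⟩ := exists_between h1
  have hk : 0 ≤ k := le_trans (by positivity) hk1.le
  rw [lt_div_iff₀ (by positivity)] at hk2
  rw [div_lt_iff₀ hJ] at hk1
  have h2 := wirtinger_of_lt hl p hk (by linarith)
  rw [← mul_pow] at h2
  exact absurd ((sq_le_sq₀ (by positivity) (norm_nonneg _)).1 h2)
    (not_le.2 hk1)

end Volterra

/-! ### Multiplication operators -/

section Multiplication

variable {l : ℝ} {a : ℝ → ℝ} (ha : MemLp a ∞ (mu l))
include ha

lemma ae_abs_le : ∀ᵐ x ∂(mu l), |a x| ≤ (eLpNormEssSup a (mu l)).toReal := by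
  have hfin : eLpNormEssSup a (mu l) ≠ ⊤ := by
    have := ha.2
    rw [eLpNorm_exponent_top] at this
    exact this.ne
  filter_upwards [ae_le_eLpNormEssSup (f := a) (μ := mu l)] with x hx
  rw [← Real.norm_eq_abs, ← toReal_enorm]
  exact ENNReal.toReal_mono hfin hx

lemma ae_essInf_le_of_memLp : ∀ᵐ x ∂(mu l), essInf a (mu l) ≤ a x :=
  ae_essInf_le ⟨-(eLpNormEssSup a (mu l)).toReal, by
    rw [eventually_map]
    filter_upwards [ae_abs_le ha] with x hx using (abs_le.1 hx).1⟩

lemma ae_le_essSup_of_memLp : ∀ᵐ x ∂(mu l), a x ≤ essSup a (mu l) :=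
  ae_le_essSup ⟨(eLpNormEssSup a (mu l)).toReal, by
    rw [eventually_map]
    filter_upwards [ae_abs_le ha] with x hx using (abs_le.1 hx).2⟩

lemma mulL_ae (u : L2 l) : mulL ha u =ᵐ[mu l] fun y => a y * u y :=
  MemLp.coeFn_toLp ((Lp.memLp u).mul' ha (r := 2))

/-- Multiplication by an essentially bounded function, as a bounded operator. -/
def mulC : L2 l →L[ℝ] L2 l :=
  (mulL ha).mkContinuous (eLpNormEssSup a (mu l)).toReal fun u => by
    refine Lp.norm_le_mul_norm_of_ae_le_mul ?_
    filter_upwards [mulL_ae ha u, ae_abs_le ha] with x h1 h2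
    rw [h1, norm_mul]
    exact mul_le_mul_of_nonneg_right h2 (norm_nonneg _)

lemma inner_mulL (u v : L2 l) : inner ℝ (mulL ha u) v = ∫ y, a y * u y * v y ∂(mu l) := by
  rw [inner_eq_integral]
  refine integral_congr_ae ?_
  filter_upwards [mulL_ae ha u] with x h1
  rw [h1]

lemma integrable_mul_mul (u v : L2 l) : Integrable (fun y => a y * u y * v y) (mu l) := by
  refine (L2.integrable_inner (𝕜 := ℝ) v (mulL ha u)).congr ?_
  filter_upwards [mulL_ae ha u] with x h1
  simp [h1]

lemma inner_mulL_comm (u v : L2 l) : inner ℝ (mulL ha u) v = inner ℝ u (mulL ha v) := by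
  rw [real_inner_comm (mulL ha v), inner_mulL, inner_mulL]
  congr 1
  ext y
  ring

lemma le_inner_mulL {c : ℝ} (hc : ∀ᵐ y ∂(mu l), c ≤ a y) (u : L2 l) :
    c * ‖u‖ ^ 2 ≤ inner ℝ (mulL ha u) u := by
  rw [inner_mulL, ← real_inner_self_eq_norm_sq, inner_eq_integral, ← integral_const_mul]
  refine integral_mono_ae ?_ (integrable_mul_mul ha u u) ?_
  · have : Integrable (fun y => u y * u y) (mu l) := integrable_mul_self u
    exact this.const_mul _
  · filter_upwards [hc] with x hx
    nlinarith [mul_self_nonneg (u x)]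

lemma inner_mulL_le {c : ℝ} (hc : ∀ᵐ y ∂(mu l), a y ≤ c) (u : L2 l) :
    inner ℝ (mulL ha u) u ≤ c * ‖u‖ ^ 2 := by
  rw [inner_mulL, ← real_inner_self_eq_norm_sq, inner_eq_integral, ← integral_const_mul]
  refine integral_mono_ae (integrable_mul_mul ha u u) ?_ ?_
  · have : Integrable (fun y => u y * u y) (mu l) := integrable_mul_self u
    exact this.const_mul _
  · filter_upwards [hc] with x hx
    nlinarith [mul_self_nonneg (u x)]

lemma memLp_sqrt : MemLp (fun y => √(a y)) ∞ (mu l) := by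
  refine memLp_top_of_bound ?_ (√(eLpNormEssSup a (mu l)).toReal) ?_
  · exact Real.continuous_sqrt.comp_aestronglyMeasurable ha.aestronglyMeasurable
  · filter_upwards [ae_abs_le ha] with x hx
    rw [Real.norm_of_nonneg (Real.sqrt_nonneg _)]
    exact Real.sqrt_le_sqrt ((le_abs_self _).trans hx)

lemma mulL_mulL {b c : ℝ → ℝ} (hb : MemLp b ∞ (mu l)) (hc : MemLp c ∞ (mu l))
    (h : ∀ᵐ y ∂(mu l), a y * b y = c y) (u : L2 l) : mulL ha (mulL hb u) = mulL hc u := by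
  refine Lp.ext ?_
  filter_upwards [mulL_ae ha (mulL hb u), mulL_ae hb u, mulL_ae hc u, h] with x h1 h2 h3 h4
  rw [h1, h2, h3, ← h4, mul_assoc]

lemma mulL_mulL_cancel {b : ℝ → ℝ} (hb : MemLp b ∞ (mu l))
    (h : ∀ᵐ y ∂(mu l), a y * b y = 1) (u : L2 l) : mulL ha (mulL hb u) = u := by
  refine Lp.ext ?_
  filter_upwards [mulL_ae ha (mulL hb u), mulL_ae hb u, h] with x h1 h2 h4
  rw [h1, h2, ← mul_assoc, h4, one_mul]

end Multiplication

/-! ### Abstract second order systems with Kelvin–Voigt damping -/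

section DampedSystem

variable {H : Type*} [NormedAddCommGroup H] [InnerProductSpace ℝ H] [CompleteSpace H]

/-- Lax–Milgram for the bilinear form ⟨Tu, v⟩. -/
lemma surjective_of_coercive (T : H →L[ℝ] H) {d : ℝ} (hd : 0 < d)
    (h : ∀ q, d * ‖q‖ ^ 2 ≤ inner ℝ (T q) q) : Function.Surjective T := by
  let B : H →L[ℝ] H →L[ℝ] ℝ := (innerSL ℝ : H →L[ℝ] H →L[ℝ] ℝ) ∘L T
  have hB : IsCoercive B := ⟨d, hd, fun u => by
    have := h u
    change d * ‖u‖ * ‖u‖ ≤ inner ℝ (T u) u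
    nlinarith⟩
  have e : ∀ v, hB.continuousLinearEquivOfBilin v = T v := fun v =>
    ext_inner_right ℝ fun w => hB.continuousLinearEquivOfBilin_apply v w
  intro y
  obtain ⟨v, hv⟩ := hB.continuousLinearEquivOfBilin.surjective y
  exact ⟨v, by rw [← e, hv]⟩

/-- The first order form `(p, K q) ↦ (q, -r)`, `S p + D q = K* r`, of a second order system with
coercive damping `D` is quasi-m-dissipative. -/
theorem exists_isQuasiMDissipative_of_damped (K S D : H →L[ℝ] H) {d : ℝ} (hd : 0 < d)
    (hD : ∀ q, d * ‖q‖ ^ 2 ≤ inner ℝ (D q) q)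
    {G : WithLp 2 (H × H) →ₗ.[ℝ] WithLp 2 (H × H)}
    (h1 : ∀ x : G.domain, ∃ q r : H, (x : WithLp 2 (H × H)).snd = K q ∧
      S (x : WithLp 2 (H × H)).fst + D q = K.adjoint r ∧ G x = WithLp.toLp 2 (q, -r))
    (h2 : ∀ p q r : H, S p + D q = K.adjoint r →
      ∃ h : WithLp.toLp 2 (p, K q) ∈ G.domain, G ⟨_, h⟩ = WithLp.toLp 2 (q, -r)) :
    ∃ b, IsQuasiMDissipative G b := by
  refine ⟨(1 + ‖S‖) ^ 2 / (4 * d), fun x => ?_, fun c hc y => ?_⟩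
  · obtain ⟨q, r, hq, hr, hG⟩ := h1 x
    rw [hG, WithLp.prod_inner_apply, WithLp.prod_norm_sq_eq_of_L2]
    set p := (x : WithLp 2 (H × H)).fst with hp
    change inner ℝ q p + inner ℝ (-r) (x : WithLp 2 (H × H)).snd ≤ _
    -- The unbounded contribution ⟨r, Kq⟩ = ⟨K*r, q⟩ is traded for stiffness and damping.
    have e1 : inner ℝ r (K q) = inner ℝ (S p) q + inner ℝ (D q) q := by
      rw [← ContinuousLinearMap.adjoint_inner_left, ← hr, inner_add_left]
    rw [hq, inner_neg_left, e1]
    have e2 := real_inner_le_norm q p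
    have e3 := neg_le_of_abs_le (abs_real_inner_le_norm (S p) q)
    have e4 := mul_le_mul_of_nonneg_right (S.le_opNorm p) (norm_nonneg q)
    have e5 := hD q
    -- Young's inequality, with the damping absorbing ‖q‖²; this fixes the value of b.
    have e6 : (1 + ‖S‖) * ‖p‖ * ‖q‖ - d * ‖q‖ ^ 2 ≤ (1 + ‖S‖) ^ 2 / (4 * d) * ‖p‖ ^ 2 := by
      rw [div_mul_eq_mul_div, le_div_iff₀ (by positivity)]
      nlinarith [sq_nonneg ((1 + ‖S‖) * ‖p‖ - 2 * d * ‖q‖)]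
    have e7 : 0 ≤ (1 + ‖S‖) ^ 2 / (4 * d) * ‖K q‖ ^ 2 := by positivity
    nlinarith
  · have hS := norm_nonneg S
    have hc0 : 0 < c := lt_of_le_of_lt (by positivity) hc
    -- cd > (1 + ‖S‖)²/4 ≥ ‖S‖.
    have hcS : ‖S‖ < c * d := by
      rw [div_lt_iff₀ (by positivity)] at hc
      nlinarith [sq_nonneg (1 - ‖S‖)]
    -- The resolvent equation says cp - q = y₁ and cKq + r = y₂. Substituting p = (q + y₁)/c and r =
    -- y₂ - cKq into Sp + Dq = K*r gives Tq = K*y₂ - Sy₁/c.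
    let T : H →L[ℝ] H := c⁻¹ • S + D + c • (K.adjoint ∘L K)
    have hT : ∀ q, (d - c⁻¹ * ‖S‖) * ‖q‖ ^ 2 ≤ inner ℝ (T q) q := fun q => by
      have e : inner ℝ (T q) q = c⁻¹ * inner ℝ (S q) q + inner ℝ (D q) q + c * ‖K q‖ ^ 2 := by
        simp only [T, add_apply, smul_apply, ContinuousLinearMap.comp_apply, inner_add_left,
          inner_smul_left, ContinuousLinearMap.adjoint_inner_left, real_inner_self_eq_norm_sq,
          conj_trivial]
      have e3 := neg_le_of_abs_le (abs_real_inner_le_norm (S q) q)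
      have e4 := mul_le_mul_of_nonneg_right (S.le_opNorm q) (norm_nonneg q)
      have e5 := hD q
      have e6 : 0 ≤ c * ‖K q‖ ^ 2 := by positivity
      have e7 : c⁻¹ * -(‖S‖ * ‖q‖ ^ 2) ≤ c⁻¹ * inner ℝ (S q) q :=
        mul_le_mul_of_nonneg_left (by nlinarith) (inv_nonneg.2 hc0.le)
      rw [e]
      nlinarith
    have hpos : 0 < d - c⁻¹ * ‖S‖ := by
      rw [sub_pos, inv_mul_lt_iff₀ hc0]; exact hcS
    obtain ⟨q, hq⟩ := surjective_of_coercive T hpos hT (K.adjoint y.snd - c⁻¹ • S y.fst)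
    obtain ⟨h, hG⟩ := h2 (c⁻¹ • (q + y.fst)) q (y.snd - c • K q) (by
      have hq' : c⁻¹ • S q + D q + c • K.adjoint (K q) = K.adjoint y.snd - c⁻¹ • S y.fst := hq
      rw [map_smul, map_add, map_sub, map_smul, smul_add, eq_sub_iff_add_eq]
      rw [eq_sub_iff_add_eq] at hq'
      rw [← hq']
      abel)
    refine ⟨⟨_, h⟩, ?_⟩
    rw [hG]
    refine (WithLp.ofLp_injective 2) (Prod.ext ?_ ?_)
    · simp [smul_smul, hc0.ne']
    · simp

end DampedSystem

/-! ### Block diagonal operators -/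

section Block

variable {H₁ H₂ : Type*} [NormedAddCommGroup H₁] [InnerProductSpace ℝ H₁]
  [NormedAddCommGroup H₂] [InnerProductSpace ℝ H₂]

/-- The block diagonal operator with blocks `S` and `T`. -/
def blockDiag (S : H₁ →L[ℝ] H₁) (T : H₂ →L[ℝ] H₂) : WithLp 2 (H₁ × H₂) →L[ℝ] WithLp 2 (H₁ × H₂) :=
  ((WithLp.prodContinuousLinearEquiv 2 ℝ H₁ H₂).symm : H₁ × H₂ →L[ℝ] WithLp 2 (H₁ × H₂)) ∘L
    S.prodMap T ∘L (WithLp.prodContinuousLinearEquiv 2 ℝ H₁ H₂ : WithLp 2 (H₁ × H₂) →L[ℝ] H₁ × H₂)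

lemma blockDiag_apply (S : H₁ →L[ℝ] H₁) (T : H₂ →L[ℝ] H₂) (x : WithLp 2 (H₁ × H₂)) :
    blockDiag S T x = WithLp.toLp 2 (S x.fst, T x.snd) := rfl

lemma adjoint_blockDiag [CompleteSpace H₁] [CompleteSpace H₂] (S : H₁ →L[ℝ] H₁)
    (T : H₂ →L[ℝ] H₂) : (blockDiag S T).adjoint = blockDiag S.adjoint T.adjoint := by
  symm
  rw [ContinuousLinearMap.eq_adjoint_iff]
  intro x y
  simp only [blockDiag_apply, WithLp.prod_inner_apply]
  simp [ContinuousLinearMap.adjoint_inner_left]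

lemma le_inner_blockDiag {S : H₁ →L[ℝ] H₁} {T : H₂ →L[ℝ] H₂} {c d : ℝ}
    (hS : ∀ q, c * ‖q‖ ^ 2 ≤ inner ℝ (S q) q) (hT : ∀ q, d * ‖q‖ ^ 2 ≤ inner ℝ (T q) q)
    (q : WithLp 2 (H₁ × H₂)) : min c d * ‖q‖ ^ 2 ≤ inner ℝ (blockDiag S T q) q := by
  rw [blockDiag_apply, WithLp.prod_inner_apply, WithLp.prod_norm_sq_eq_of_L2, mul_add]
  exact add_le_add
    ((mul_le_mul_of_nonneg_right (min_le_left _ _) (sq_nonneg _)).trans (hS q.fst))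
    ((mul_le_mul_of_nonneg_right (min_le_right _ _) (sq_nonneg _)).trans (hT q.snd))

end Block

/-! ### Equivalent inner products -/

lemma conjPMap_domain {E F : Type*} [NormedAddCommGroup E] [InnerProductSpace ℝ E]
    [AddCommGroup F] [Module ℝ F] (e : F ≃ₗ[ℝ] E) (G : F →ₗ.[ℝ] F) :
    (conjPMap e G).domain = G.domain.comap e.symm.toLinearMap := rfl

lemma conjPMap_apply {E F : Type*} [NormedAddCommGroup E] [InnerProductSpace ℝ E]
    [AddCommGroup F] [Module ℝ F] (e : F ≃ₗ[ℝ] E) (G : F →ₗ.[ℝ] F) {x : E}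
    (h : e.symm x ∈ G.domain) : conjPMap e G ⟨x, h⟩ = e (G ⟨e.symm x, h⟩) := rfl

section Equivalent

variable {E F : Type*} [NormedAddCommGroup E] [InnerProductSpace ℝ E] [CompleteSpace E]
  [AddCommGroup F] [Module ℝ F]

/-- An inner product equivalent to that of a Hilbert space `E` makes `F ≃ E` a Hilbert space, in
which generation can be tested in `E`. -/
theorem isHilbert_and_generates_of_equivalent (c : InnerProductSpace.Core ℝ F) (e : F ≃ₗ[ℝ] E)
    {m C : ℝ} (hm : 0 < m) (hC : 0 ≤ C) (h1 : ∀ X, m * ‖e X‖ ^ 2 ≤ c.inner X X)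
    (h2 : ∀ X, c.inner X X ≤ C * ‖e X‖ ^ 2) :
    IsHilbert c ∧ ∀ (G : F →ₗ.[ℝ] F) (b : ℝ), IsQuasiMDissipative (conjPMap e G) b →
      GeneratesC0Semigroup c G := by
  let : NormedAddCommGroup F := c.toNormedAddCommGroup
  let : InnerProductSpace ℝ F := InnerProductSpace.ofCore c.toCore
  have hn : ∀ X : F, ‖X‖ ^ 2 = c.inner X X := fun X => (real_inner_self_eq_norm_sq X).symm
  let e' : F ≃L[ℝ] E := e.toContinuousLinearEquivOfBounds (√m)⁻¹ (√C) (fun X => by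
      rw [inv_mul_eq_div, le_div_iff₀ (Real.sqrt_pos.2 hm)]
      refine (sq_le_sq₀ (by positivity) (norm_nonneg _)).1 ?_
      rw [mul_pow, Real.sq_sqrt hm.le, hn, mul_comm]
      exact h1 X) (fun x => by
      refine (sq_le_sq₀ (norm_nonneg _) (by positivity)).1 ?_
      rw [mul_pow, Real.sq_sqrt hC, hn]
      simpa using h2 (e.symm x))
  refine ⟨?_, fun G b hG => hG.exists_c0Semigroup_of_equiv e'⟩
  exact (completeSpace_congr (e := e'.toEquiv) e'.isUniformEmbedding).2 inferInstance

end Equivalent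

/-! ### Moments and torques -/

section Moments

variable {l : ℝ} (hl : 0 < l)
include hl

/-- Integrating twice from the tip, m' = κ - J*s and m = -J*m' when m(l) = 0. Regularity, both
endpoint values and the equation thus become one identity in L². -/
lemma bending_iff (m s : L2 l) (κ : ℝ) :
    (m ∈ H2 l ∧ val m l = 0 ∧ val (wd m) l = κ ∧ wd (wd m) = s) ↔
      m = (J hl).adjoint ((J hl).adjoint s) - κ • (J hl).adjoint (one l) := by
  have hr := right_mem_Icc.2 hl.le
  constructor
  · rintro ⟨hm, h0, rfl, rfl⟩
    conv_lhs => rw [eq_val_right_sub hl hm.1, eq_val_right_sub hl hm.2, h0]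
    simp
  · intro h
    have hm : m = (0:ℝ) • one l + (J hl).adjoint ((J hl).adjoint s - κ • one l) := by
      rw [h]; simp
    have hd : wd m = κ • one l + (J hl).adjoint (-s) := by
      rw [hm, wd_add_adjoint_J]; simp; abel
    have hone := Submodule.smul_mem (H1 l) κ (one_mem_H1 hl)
    have hdm : wd m ∈ H1 l := by rw [hd]; exact add_mem hone (adjoint_J_mem hl _)
    refine ⟨⟨?_, hdm⟩, ?_, ?_, ?_⟩
    · rw [hm, zero_smul, zero_add]; exact adjoint_J_mem hl _
    · rw [hm, zero_smul, zero_add]; exact val_adjoint_J hl _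
    · rw [hd, val_add hl hone (adjoint_J_mem hl _) hr, val_smul hl _ (one_mem_H1 hl) hr,
        val_one hl hr, val_adjoint_J hl]
      ring
    · rw [hd, wd_add_adjoint_J, neg_neg]

/-- The analogue with a single integration from the tip. -/
lemma torsion_iff (m s : L2 l) (κ : ℝ) :
    (m ∈ H1 l ∧ val m l = κ ∧ wd m = s) ↔ m = κ • one l - (J hl).adjoint s := by
  have hr := right_mem_Icc.2 hl.le
  constructor
  · rintro ⟨hm, rfl, rfl⟩
    exact eq_val_right_sub hl hm
  · intro h
    have hm : m = κ • one l + (J hl).adjoint (-s) := by rw [h, map_neg, sub_eq_add_neg]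
    have hone := Submodule.smul_mem (H1 l) κ (one_mem_H1 hl)
    refine ⟨?_, ?_, ?_⟩
    · rw [hm]; exact add_mem hone (adjoint_J_mem hl _)
    · rw [hm, val_add hl hone (adjoint_J_mem hl _) hr, val_smul hl _ (one_mem_H1 hl) hr,
        val_one hl hr, val_adjoint_J hl]
      ring
    · rw [hm, wd_add_adjoint_J, neg_neg]

end Moments

/-! ### Weighted bounds for the cross terms. -/

section CrossTerm

variable {l : ℝ} {a e : ℝ → ℝ}

lemma inner_mulL_symm (ha : MemLp a ∞ (mu l)) (u v : L2 l) :
    inner ℝ (mulL ha u) v = inner ℝ (mulL ha v) u := by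
  rw [inner_mulL_comm, real_inner_comm]

lemma ae_sqrt_mul_sqrt_inv (ha : MemLp a ∞ (mu l)) (hpos : 0 < essInf a (mu l)) :
    ∀ᵐ y ∂(mu l), √(a y) * √(1 / a y) = 1 := by
  filter_upwards [ae_essInf_le_of_memLp ha] with y hy
  have : 0 < a y := hpos.trans_le hy
  rw [← Real.sqrt_mul this.le, mul_one_div_cancel this.ne', Real.sqrt_one]

lemma ae_sqrt_mul_inv (ha : MemLp a ∞ (mu l)) (hpos : 0 < essInf a (mu l)) :
    ∀ᵐ y ∂(mu l), √(a y) * (1 / a y) = √(1 / a y) := by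
  filter_upwards [ae_essInf_le_of_memLp ha] with y hy
  have h : 0 < a y := hpos.trans_le hy
  rw [one_div, Real.sqrt_inv, ← div_eq_mul_inv, Real.sqrt_div_self]

lemma inner_mulL_eq_inner_sqrt (ha : MemLp a ∞ (mu l)) (hpos : 0 < essInf a (mu l)) (u v : L2 l) :
    inner ℝ (mulL ha u) v = inner ℝ (mulL (memLp_sqrt ha) u) (mulL (memLp_sqrt ha) v) := by
  rw [← inner_mulL_comm, mulL_mulL (memLp_sqrt ha) (memLp_sqrt ha) ha]
  filter_upwards [ae_essInf_le_of_memLp ha] with y hy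
  exact Real.mul_self_sqrt (hpos.trans_le hy).le

/-- With s = √(ess sup a), Cauchy–Schwarz in the weight a and 2xy ≤ x² + y² bound the left side by
s(c²‖p‖² + ‖√a g‖²). The lower bound of e turns ‖p‖² into the elastic energy, which accounts for the
two conditions on k and so for the entries of K_m. -/
lemma abs_two_mul_inner_mulL_le (ha : MemLp a ∞ (mu l)) (hapos : 0 < essInf a (mu l))
    (he : MemLp e ∞ (mu l)) (hepos : 0 < essInf e (mu l)) {f p : L2 l} {c k : ℝ}
    (hf : ‖f‖ ≤ c * ‖p‖) (h1 : √(essSup a (mu l)) ≤ k)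
    (h2 : c ^ 2 * √(essSup a (mu l)) / essInf e (mu l) ≤ k) (g : L2 l) :
    |2 * inner ℝ (mulL ha f) g| ≤ k * (inner ℝ (mulL he p) p + inner ℝ (mulL ha g) g) := by
  set s := √(essSup a (mu l))
  have hs : 0 ≤ s := Real.sqrt_nonneg _
  have e1 : ‖mulL (memLp_sqrt ha) f‖ ≤ s * ‖f‖ := by
    rw [← Real.sqrt_sq (norm_nonneg (mulL (memLp_sqrt ha) f)), ← real_inner_self_eq_norm_sq,
      ← inner_mulL_eq_inner_sqrt ha hapos]
    refine (Real.sqrt_le_sqrt (inner_mulL_le ha (ae_le_essSup_of_memLp ha) f)).trans ?_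
    rw [Real.sqrt_mul' _ (sq_nonneg _), Real.sqrt_sq (norm_nonneg _)]
  have e2 : inner ℝ (mulL ha g) g = ‖mulL (memLp_sqrt ha) g‖ ^ 2 := by
    rw [inner_mulL_eq_inner_sqrt ha hapos, real_inner_self_eq_norm_sq]
  have e3 := le_inner_mulL he (ae_essInf_le_of_memLp he) p
  have e4 : |inner ℝ (mulL ha f) g| ≤ (s * (c * ‖p‖)) * ‖mulL (memLp_sqrt ha) g‖ := by
    rw [inner_mulL_eq_inner_sqrt ha hapos]
    refine (abs_real_inner_le_norm _ _).trans (mul_le_mul_of_nonneg_right ?_ (norm_nonneg _))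
    exact e1.trans (mul_le_mul_of_nonneg_left hf hs)
  have e5 : c ^ 2 * s * ‖p‖ ^ 2 ≤ k * inner ℝ (mulL he p) p := by
    rw [div_le_iff₀ hepos] at h2
    have hk : 0 ≤ k := hs.trans h1
    nlinarith [mul_le_mul_of_nonneg_right h2 (sq_nonneg ‖p‖), mul_le_mul_of_nonneg_left e3 hk]
  rw [abs_mul, abs_two, e2]
  set t := ‖mulL (memLp_sqrt ha) g‖
  nlinarith [mul_nonneg hs (sq_nonneg (c * ‖p‖ - t)), mul_le_mul_of_nonneg_right h1 (sq_nonneg t)]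

end CrossTerm

namespace Wing

variable (W : Wing)

/-! ### Coordinates on the state space -/

/-- The Volterra operator on the wing. -/
abbrev J : L2 W.l →L[ℝ] L2 W.l := FlexibleWing.J W.l_pos

variable {W} in
lemma eq_J_J {u : L2 W.l} (hu : u ∈ W.H2c) : u = W.J (W.J (wd (wd u))) := by
  obtain ⟨h1, h2, h3⟩ := hu
  have e1 := eq_val_left_add_J W.l_pos h1.1
  have e2 := eq_val_left_add_J W.l_pos h1.2
  rw [h2, zero_smul, zero_add] at e1
  rw [h3, zero_smul, zero_add] at e2
  rw [← e2, ← e1]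

variable {W} in
lemma eq_J {u : L2 W.l} (hu : u ∈ W.H1c) : u = W.J (wd u) := by
  have e1 := eq_val_left_add_J W.l_pos hu.1
  rwa [hu.2, zero_smul, zero_add] at e1

lemma J_J_mem (p : L2 W.l) : W.J (W.J p) ∈ W.H2c :=
  ⟨⟨J_mem_H1 _ _, by rw [wd_J]; exact J_mem_H1 _ _⟩, val_J_left _ _,
    by rw [wd_J]; exact val_J_left _ _⟩

lemma J_mem (p : L2 W.l) : W.J p ∈ W.H1c := ⟨J_mem_H1 _ _, val_J_left _ _⟩

/-- The Hilbert space of strains, bending and torsion. -/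
abbrev Strain : Type := WithLp 2 (L2 W.l × L2 W.l)

/-- The Hilbert space of strains and weighted velocities. -/
abbrev Coord : Type := WithLp 2 (W.Strain × W.Strain)

/-- The coordinates `(f'', h', √ρ g, √Iw z)` of a state. -/
def coord : W.State ≃ₗ[ℝ] W.Coord where
  toFun X := WithLp.toLp 2 (WithLp.toLp 2 (wd (wd (W.f X)), wd (W.h X)),
    WithLp.toLp 2 (mulL (memLp_sqrt W.ρ_mem) (W.g X), mulL (memLp_sqrt W.Iw_mem) (W.z X)))
  invFun x := W.mkState (W.J (W.J x.fst.fst))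
    (mulL (memLp_sqrt (memLp_inv W.ρ_mem W.ρ_pos)) x.snd.fst) (W.J x.fst.snd)
    (mulL (memLp_sqrt (memLp_inv W.Iw_mem W.Iw_pos)) x.snd.snd) (W.J_J_mem _) (W.J_mem _)
  map_add' X Y := by
    simp only [map_add, wd_wd_add (W.f_mem X).1 (W.f_mem Y).1, wd_add (W.h_mem X).1 (W.h_mem Y).1]
    rfl
  map_smul' c X := by
    simp only [map_smul, wd_wd_smul c (W.f_mem X).1, wd_smul c (W.h_mem X).1]
    rfl
  left_inv X := by
    ext1
    · exact (eq_J_J (W.f_mem X)).symm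
    · refine mulL_mulL_cancel (memLp_sqrt (memLp_inv W.ρ_mem W.ρ_pos)) _ ?_ _
      filter_upwards [ae_sqrt_mul_sqrt_inv W.ρ_mem W.ρ_pos] with y hy
      rwa [mul_comm]
    · exact (eq_J (W.h_mem X)).symm
    · refine mulL_mulL_cancel (memLp_sqrt (memLp_inv W.Iw_mem W.Iw_pos)) _ ?_ _
      filter_upwards [ae_sqrt_mul_sqrt_inv W.Iw_mem W.Iw_pos] with y hy
      rwa [mul_comm]
  right_inv x := by
    simp only [f_mkState, g_mkState, h_mkState, z_mkState, wd_J,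
      mulL_mulL_cancel _ _ (ae_sqrt_mul_sqrt_inv W.ρ_mem W.ρ_pos),
      mulL_mulL_cancel _ _ (ae_sqrt_mul_sqrt_inv W.Iw_mem W.Iw_pos)]
    rfl

/-! ### The inner products -/

lemma inner1_eq (X Y : W.State) : W.inner1 X Y =
    inner ℝ (mulL W.EI_mem (wd (wd (W.f X)))) (wd (wd (W.f Y)))
    + inner ℝ (mulL W.ρ_mem (W.g X)) (W.g Y)
    + (inner ℝ (mulL W.GJ_mem (wd (W.h X))) (wd (W.h Y))
    + inner ℝ (mulL W.Iw_mem (W.z X)) (W.z Y)) := by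
  simp only [inner1, inner_mulL]
  rw [integral_add (integrable_mul_mul W.EI_mem _ _) (integrable_mul_mul W.ρ_mem _ _),
    integral_add (integrable_mul_mul W.GJ_mem _ _) (integrable_mul_mul W.Iw_mem _ _)]

lemma inner2_eq (ε₁ ε₂ : ℝ) (X Y : W.State) : W.inner2 ε₁ ε₂ X Y = W.inner1 X Y
    + ε₁ * (inner ℝ (mulL W.ρ_mem (W.f X)) (W.g Y) + inner ℝ (mulL W.ρ_mem (W.g X)) (W.f Y))
    + ε₂ * (inner ℝ (mulL W.Iw_mem (W.h X)) (W.z Y) + inner ℝ (mulL W.Iw_mem (W.z X)) (W.h Y)) := by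
  simp only [inner2, inner_mulL]
  rw [← integral_add (integrable_mul_mul W.ρ_mem _ _) (integrable_mul_mul W.ρ_mem _ _),
    ← integral_add (integrable_mul_mul W.Iw_mem _ _) (integrable_mul_mul W.Iw_mem _ _)]
  simp only [mul_add, mul_assoc]

/-- This is the energy with EI and GJ replaced by 1; only their bounds separate it from `inner1`. -/
lemma norm_coord_sq (X : W.State) : ‖W.coord X‖ ^ 2 =
    ‖wd (wd (W.f X))‖ ^ 2 + inner ℝ (mulL W.ρ_mem (W.g X)) (W.g X)
    + (‖wd (W.h X)‖ ^ 2 + inner ℝ (mulL W.Iw_mem (W.z X)) (W.z X)) := by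
  rw [inner_mulL_eq_inner_sqrt W.ρ_mem W.ρ_pos, inner_mulL_eq_inner_sqrt W.Iw_mem W.Iw_pos,
    real_inner_self_eq_norm_sq, real_inner_self_eq_norm_sq, WithLp.prod_norm_sq_eq_of_L2,
    WithLp.prod_norm_sq_eq_of_L2, WithLp.prod_norm_sq_eq_of_L2]
  change ‖wd (wd (W.f X))‖ ^ 2 + ‖wd (W.h X)‖ ^ 2 + (‖mulL (memLp_sqrt W.ρ_mem) (W.g X)‖ ^ 2
    + ‖mulL (memLp_sqrt W.Iw_mem) (W.z X)‖ ^ 2) = _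
  ring

lemma le_inner1_self (X : W.State) :
    min (min (essInf W.EI (mu W.l)) (essInf W.GJ (mu W.l))) 1 * ‖W.coord X‖ ^ 2
      ≤ W.inner1 X X := by
  rw [inner1_eq, norm_coord_sq]
  set m := min (min (essInf W.EI (mu W.l)) (essInf W.GJ (mu W.l))) 1
  have m1 : m ≤ essInf W.EI (mu W.l) := (min_le_left _ _).trans (min_le_left _ _)
  have m2 : m ≤ essInf W.GJ (mu W.l) := (min_le_left _ _).trans (min_le_right _ _)
  have m3 : m ≤ 1 := min_le_right _ _
  have h1 := le_inner_mulL W.EI_mem (ae_essInf_le_of_memLp W.EI_mem) (wd (wd (W.f X)))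
  have h2 := le_inner_mulL W.GJ_mem (ae_essInf_le_of_memLp W.GJ_mem) (wd (W.h X))
  have h3 := inner_mulL_eq_inner_sqrt W.ρ_mem W.ρ_pos (W.g X) (W.g X)
  have h4 := inner_mulL_eq_inner_sqrt W.Iw_mem W.Iw_pos (W.z X) (W.z X)
  rw [real_inner_self_eq_norm_sq] at h3 h4
  rw [h3, h4]
  nlinarith [mul_le_mul_of_nonneg_right m1 (sq_nonneg ‖wd (wd (W.f X))‖),
    mul_le_mul_of_nonneg_right m2 (sq_nonneg ‖wd (W.h X)‖),
    mul_le_mul_of_nonneg_right m3 (sq_nonneg ‖mulL (memLp_sqrt W.ρ_mem) (W.g X)‖),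
    mul_le_mul_of_nonneg_right m3 (sq_nonneg ‖mulL (memLp_sqrt W.Iw_mem) (W.z X)‖)]

lemma inner1_self_le (X : W.State) :
    W.inner1 X X ≤
      max (max (essSup W.EI (mu W.l)) (essSup W.GJ (mu W.l))) 1 * ‖W.coord X‖ ^ 2 := by
  rw [inner1_eq, norm_coord_sq]
  set m := max (max (essSup W.EI (mu W.l)) (essSup W.GJ (mu W.l))) 1
  have m1 : essSup W.EI (mu W.l) ≤ m := (le_max_left _ _).trans (le_max_left _ _)
  have m2 : essSup W.GJ (mu W.l) ≤ m := (le_max_right _ _).trans (le_max_left _ _)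
  have m3 : 1 ≤ m := le_max_right _ _
  have h1 := inner_mulL_le W.EI_mem (ae_le_essSup_of_memLp W.EI_mem) (wd (wd (W.f X)))
  have h2 := inner_mulL_le W.GJ_mem (ae_le_essSup_of_memLp W.GJ_mem) (wd (W.h X))
  have h3 := inner_mulL_eq_inner_sqrt W.ρ_mem W.ρ_pos (W.g X) (W.g X)
  have h4 := inner_mulL_eq_inner_sqrt W.Iw_mem W.Iw_pos (W.z X) (W.z X)
  rw [real_inner_self_eq_norm_sq] at h3 h4
  rw [h3, h4]
  nlinarith [mul_le_mul_of_nonneg_right m1 (sq_nonneg ‖wd (wd (W.f X))‖),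
    mul_le_mul_of_nonneg_right m2 (sq_nonneg ‖wd (W.h X)‖),
    mul_le_mul_of_nonneg_right m3 (sq_nonneg ‖mulL (memLp_sqrt W.ρ_mem) (W.g X)‖),
    mul_le_mul_of_nonneg_right m3 (sq_nonneg ‖mulL (memLp_sqrt W.Iw_mem) (W.z X)‖)]

/-- As f = J²f'' and h = Jh', Wirtinger's inequality applies twice to f and once to h. The squared
factors (2l/π)⁴ and (2l/π)² are the constants of K_m. -/
lemma abs_inner2_sub_inner1_le {ε₁ ε₂ : ℝ} (h1 : 0 ≤ ε₁) (h2 : 0 ≤ ε₂) (X : W.State) :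
    |W.inner2 ε₁ ε₂ X X - W.inner1 X X| ≤ max ε₁ ε₂ * W.Km * W.inner1 X X := by
  have hf : ‖W.f X‖ ≤ (2 * W.l / Real.pi) ^ 2 * ‖wd (wd (W.f X))‖ := by
    conv_lhs => rw [eq_J_J (W.f_mem X)]
    refine (norm_J_le W.l_pos _).trans ?_
    rw [pow_two, mul_assoc]
    have := W.l_pos
    exact mul_le_mul_of_nonneg_left (norm_J_le W.l_pos _) (by positivity)
  have hh : ‖W.h X‖ ≤ 2 * W.l / Real.pi * ‖wd (W.h X)‖ := by
    conv_lhs => rw [eq_J (W.h_mem X)]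
    exact norm_J_le W.l_pos _
  have c1 := abs_two_mul_inner_mulL_le W.ρ_mem W.ρ_pos W.EI_mem W.EI_pos (k := W.Km) hf
    ((le_max_left _ _).trans (le_max_left _ _))
    ((le_of_eq (by ring)).trans ((le_max_right _ _).trans (le_max_left _ _))) (W.g X)
  have c2 := abs_two_mul_inner_mulL_le W.Iw_mem W.Iw_pos W.GJ_mem W.GJ_pos (k := W.Km) hh
    ((le_max_left _ _).trans (le_max_right _ _))
    ((le_of_eq (by ring)).trans ((le_max_right _ _).trans (le_max_right _ _))) (W.z X)
  set b := inner ℝ (mulL W.EI_mem (wd (wd (W.f X)))) (wd (wd (W.f X)))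
    + inner ℝ (mulL W.ρ_mem (W.g X)) (W.g X) with hb
  set t := inner ℝ (mulL W.GJ_mem (wd (W.h X))) (wd (W.h X))
    + inner ℝ (mulL W.Iw_mem (W.z X)) (W.z X) with ht
  have e1 : inner ℝ (mulL W.ρ_mem (W.g X)) (W.f X) = inner ℝ (mulL W.ρ_mem (W.f X)) (W.g X) := by
    exact inner_mulL_symm _ _ _
  have e2 : inner ℝ (mulL W.Iw_mem (W.z X)) (W.h X) = inner ℝ (mulL W.Iw_mem (W.h X)) (W.z X) := by
    exact inner_mulL_symm _ _ _
  rw [inner2_eq, e1, e2, inner1_eq, ← hb, ← ht, ← two_mul, ← two_mul, add_assoc (b + t),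
    add_sub_cancel_left]
  refine (abs_add_le _ _).trans ?_
  rw [abs_mul ε₁, abs_mul ε₂, abs_of_nonneg h1, abs_of_nonneg h2]
  have k1 := mul_le_mul (le_max_left ε₁ ε₂) c1 (abs_nonneg _) (h1.trans (le_max_left _ _))
  have k2 := mul_le_mul (le_max_right ε₁ ε₂) c2 (abs_nonneg _) (h1.trans (le_max_left _ _))
  linarith

lemma Km_pos : 0 < W.Km := by
  refine lt_of_lt_of_le (Real.sqrt_pos.2 ?_) ((le_max_left _ _).trans (le_max_left _ _))
  -- Positive length is needed to compare essential infimum and supremum at a common point.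
  have : (ae (mu W.l)).NeBot := by
    rw [ae_neBot]
    intro h
    have := congrArg (fun m : Measure ℝ => m univ) h
    simp at this
    linarith [W.l_pos]
  obtain ⟨x, h1, h2⟩ := ((ae_essInf_le_of_memLp W.ρ_mem).and
    (ae_le_essSup_of_memLp W.ρ_mem)).exists
  linarith [W.ρ_pos]

/-- The inner product `⟨·,·⟩_{ℋ,2}` is equivalent to that of the coordinate space. -/
lemma exists_equivalent {ε₁ ε₂ : ℝ} (h1 : 0 ≤ ε₁) (h1' : ε₁ < 1 / W.Km) (h2 : 0 ≤ ε₂)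
    (h2' : ε₂ < 1 / W.Km) : ∃ m C : ℝ, 0 < m ∧ 0 ≤ C ∧
      (∀ X, m * ‖W.coord X‖ ^ 2 ≤ W.inner2 ε₁ ε₂ X X) ∧
      ∀ X, W.inner2 ε₁ ε₂ X X ≤ C * ‖W.coord X‖ ^ 2 := by
  have hK := W.Km_pos
  have hε : max ε₁ ε₂ * W.Km < 1 := by
    rw [← lt_div_iff₀ hK]; exact max_lt h1' h2'
  have hε0 : 0 ≤ max ε₁ ε₂ * W.Km := mul_nonneg (h1.trans (le_max_left _ _)) hK.le
  -- The two forms differ on the diagonal by at most δ times the energy, hence the factors 1 - δ > 0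
  -- and 1 + δ.
  set δ := max ε₁ ε₂ * W.Km with hδ
  refine ⟨(1 - δ) * min (min (essInf W.EI (mu W.l)) (essInf W.GJ (mu W.l))) 1,
    (1 + δ) * max (max (essSup W.EI (mu W.l)) (essSup W.GJ (mu W.l))) 1,
    mul_pos (by linarith) (lt_min (lt_min W.EI_pos W.GJ_pos) one_pos),
    mul_nonneg (by linarith) (zero_le_one.trans (le_max_right _ _)), fun X => ?_, fun X => ?_⟩
  · have a1 := abs_le.1 (W.abs_inner2_sub_inner1_le h1 h2 X)
    have a2 := mul_le_mul_of_nonneg_left (W.le_inner1_self X) (by linarith : 0 ≤ 1 - δ)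
    rw [mul_assoc]
    rw [← hδ] at a1
    linarith [a1.1]
  · have a1 := abs_le.1 (W.abs_inner2_sub_inner1_le h1 h2 X)
    have a2 := mul_le_mul_of_nonneg_left (W.inner1_self_le X) (by linarith : 0 ≤ 1 + δ)
    rw [mul_assoc]
    rw [← hδ] at a1
    linarith [a1.2]

/-- The inner product `⟨·,·⟩_{ℋ,2}`. -/
abbrev core {ε₁ ε₂ : ℝ} (h1 : 0 ≤ ε₁) (h1' : ε₁ < 1 / W.Km) (h2 : 0 ≤ ε₂) (h2' : ε₂ < 1 / W.Km) :
    InnerProductSpace.Core ℝ W.State where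
  inner X Y := W.inner2 ε₁ ε₂ X Y
  conj_inner_symm X Y := by
    rw [conj_trivial, inner2_eq, inner2_eq, inner1_eq, inner1_eq,
      inner_mulL_symm W.EI_mem _ (wd (wd (W.f X))), inner_mulL_symm W.GJ_mem _ (wd (W.h X)),
      inner_mulL_symm W.ρ_mem _ (W.g X), inner_mulL_symm W.ρ_mem _ (W.g X),
      inner_mulL_symm W.ρ_mem _ (W.f X), inner_mulL_symm W.Iw_mem _ (W.z X),
      inner_mulL_symm W.Iw_mem _ (W.z X), inner_mulL_symm W.Iw_mem _ (W.h X)]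
    ring
  re_inner_nonneg X := by
    obtain ⟨m, C, hm, -, h, -⟩ := W.exists_equivalent h1 h1' h2 h2'
    exact le_trans (by positivity) (h X)
  add_left X Y Z := by
    simp only [inner2_eq, inner1_eq, map_add, wd_wd_add (W.f_mem X).1 (W.f_mem Y).1,
      wd_add (W.h_mem X).1 (W.h_mem Y).1, inner_add_left]
    ring
  smul_left X Y c := by
    simp only [inner2_eq, inner1_eq, map_smul, wd_wd_smul c (W.f_mem X).1,
      wd_smul c (W.h_mem X).1, inner_smul_left, conj_trivial]
    ring
  definite X hX := by
    obtain ⟨m, C, hm, -, h, -⟩ := W.exists_equivalent h1 h1' h2 h2'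
    have h3 := h X
    change W.inner2 ε₁ ε₂ X X = 0 at hX
    rw [hX] at h3
    have h4 : ‖W.coord X‖ ^ 2 ≤ 0 := by
      by_contra! h5
      exact absurd h3 (not_le.2 (mul_pos hm h5))
    have h5 : ‖W.coord X‖ = 0 := by nlinarith [norm_nonneg (W.coord X)]
    exact W.coord.map_eq_zero_iff.1 (norm_eq_zero.1 h5)

/-! ### The operators in coordinates -/

variable (k₁ k₂ ε₁ ε₂ : ℝ)

variable {W k₁ k₂ ε₁ ε₂} in
lemma mem_domain_A {X : W.State} : X ∈ (W.A k₁ k₂ ε₁ ε₂).domain ↔ X ∈ W.domAd ∧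
    -val (wd (W.M X)) W.l + k₁ * (val (W.g X) W.l + ε₁ * val (W.f X) W.l) = 0 ∧
    val (W.N X) W.l + k₂ * (val (W.z X) W.l + ε₂ * val (W.h X) W.l) = 0 := by
  constructor
  · rintro ⟨⟨Y, hY, rfl⟩, hX⟩
    have := Prod.ext_iff.1 (LinearMap.mem_ker.1 hY)
    exact ⟨hX, this.1, this.2⟩
  · rintro ⟨hX, h1, h2⟩
    exact ⟨⟨⟨X, hX⟩, LinearMap.mem_ker.2 (Prod.ext h1 h2), rfl⟩, hX⟩

variable {k₁ k₂ ε₁ ε₂} in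
lemma A_apply {X : W.State} (hX : X ∈ (W.A k₁ k₂ ε₁ ε₂).domain)
    (hX' : X ∈ (W.A1 k₁ k₂ ε₁ ε₂).domain) :
    W.A k₁ k₂ ε₁ ε₂ ⟨X, hX⟩ = W.A1 k₁ k₂ ε₁ ε₂ ⟨X, hX'⟩ + W.A2 X := by
  change W.Ad ⟨X, _⟩ = _
  ext1 <;> rw [map_add]
  · exact (add_zero _).symm
  · change -mulL (memLp_inv W.ρ_mem W.ρ_pos) (wd (wd (W.M X)))
      + mulL W.αω_mem (W.h X) + mulL W.βω_mem (W.z X) + mulL W.γω_mem (W.g X)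
      = -mulL (memLp_inv W.ρ_mem W.ρ_pos) (wd (wd (W.M X)))
      + (mulL W.αω_mem (W.h X) + mulL W.βω_mem (W.z X) + mulL W.γω_mem (W.g X))
    abel
  · exact (add_zero _).symm
  · change mulL (memLp_inv W.Iw_mem W.Iw_pos) (wd (W.N X))
      + mulL W.αφ_mem (W.h X) + mulL W.βφ_mem (W.z X) + mulL W.γφ_mem (W.g X)
      = mulL (memLp_inv W.Iw_mem W.Iw_pos) (wd (W.N X))
      + (mulL W.αφ_mem (W.h X) + mulL W.βφ_mem (W.z X) + mulL W.γφ_mem (W.g X))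
    abel

lemma domain_A1 : (W.A1 k₁ k₂ ε₁ ε₂).domain = (W.A k₁ k₂ ε₁ ε₂).domain := rfl

lemma A_eq : W.A k₁ k₂ ε₁ ε₂ = W.A1 k₁ k₂ ε₁ ε₂ + W.A2.toPMap ⊤ := by
  refine LinearPMap.ext ?_ ?_
  · rw [LinearPMap.add_domain]
    exact (inf_top_eq _).symm
  · intro X hX hX'
    rw [LinearPMap.add_apply]
    exact W.A_apply hX hX'.1

/-- The rank one operator `q ↦ ⟨v, q⟩ v`. -/
def _root_.FlexibleWing.rankOne {l : ℝ} (v : L2 l) : L2 l →L[ℝ] L2 l := (innerSL ℝ v).smulRight v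

/-- The representative of the point evaluation of the displacement at the tip. -/
def tip : L2 W.l := W.J.adjoint (one W.l)

/-- u(l) = ⟨1, u'⟩ = ⟨1, Ju''⟩ for clamped u, so evaluation at the tip is a bounded functional of
the strain u''. -/
lemma val_tip {u : L2 W.l} (hu : u ∈ W.H2c) : val u W.l = inner ℝ W.tip (wd (wd u)) := by
  have e2 := eq_val_left_add_J W.l_pos hu.1.2
  rw [hu.2.2, zero_smul, zero_add] at e2
  rw [val_right W.l_pos hu.1.1, hu.2.1, zero_add, tip, ContinuousLinearMap.adjoint_inner_left, ← e2]

lemma val_tip' {u : L2 W.l} (hu : u ∈ W.H1c) : val u W.l = inner ℝ (one W.l) (wd u) := by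
  rw [val_right W.l_pos hu.1, hu.2, zero_add]

/-- Stiffness, including the feedback of the displacements. -/
def stiffness : W.Strain →L[ℝ] W.Strain :=
  blockDiag (mulC W.EI_mem + (k₁ * ε₁) • rankOne W.tip)
    (mulC W.GJ_mem + (k₂ * ε₂) • rankOne (one W.l))

/-- Damping, including the feedback of the velocities. -/
def damping : W.Strain →L[ℝ] W.Strain :=
  blockDiag (mulC W.ηω_mem ∘L mulC W.EI_mem + k₁ • rankOne W.tip)
    (mulC W.ηφ_mem ∘L mulC W.GJ_mem + k₂ • rankOne (one W.l))

/-- The passage from strains to weighted displacements. -/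
def displacement : W.Strain →L[ℝ] W.Strain :=
  blockDiag (mulC (memLp_sqrt W.ρ_mem) ∘L W.J ∘L W.J) (mulC (memLp_sqrt W.Iw_mem) ∘L W.J)

lemma adjoint_mulC {l : ℝ} {a : ℝ → ℝ} (ha : MemLp a ∞ (mu l)) : (mulC ha).adjoint = mulC ha := by
  symm
  rw [ContinuousLinearMap.eq_adjoint_iff]
  exact inner_mulL_comm ha

lemma adjoint_displacement (r : W.Strain) : W.displacement.adjoint r =
    WithLp.toLp 2 (W.J.adjoint (W.J.adjoint (mulL (memLp_sqrt W.ρ_mem) r.fst)),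
      W.J.adjoint (mulL (memLp_sqrt W.Iw_mem) r.snd)) := by
  rw [displacement, adjoint_blockDiag, ContinuousLinearMap.adjoint_comp,
    ContinuousLinearMap.adjoint_comp, ContinuousLinearMap.adjoint_comp, adjoint_mulC, adjoint_mulC]
  rfl

/-- Multiplication by ab is bounded below by the product of the essential infima, and the rank-one
feedback adds k⟨v, q⟩² ≥ 0. This is the coercivity of the damping. -/
lemma le_inner_mulC_comp {l : ℝ} {a b : ℝ → ℝ} (ha : MemLp a ∞ (mu l)) (hb : MemLp b ∞ (mu l))
    (hapos : 0 < essInf a (mu l)) (hbpos : 0 < essInf b (mu l)) {k : ℝ} (hk : 0 ≤ k)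
    (v q : L2 l) : essInf a (mu l) * essInf b (mu l) * ‖q‖ ^ 2
      ≤ inner ℝ ((mulC ha ∘L mulC hb + k • rankOne v) q) q := by
  have hab : MemLp (fun y => a y * b y) ∞ (mu l) := hb.mul' ha
  have e : (mulC ha ∘L mulC hb + k • rankOne v) q = mulL hab q + k • inner ℝ v q • v := by
    rw [← mulL_mulL ha hb hab (Eventually.of_forall fun _ => rfl)]
    rfl
  rw [e, inner_add_left, inner_smul_left, inner_smul_left]
  have h1 := le_inner_mulL hab (c := essInf a (mu l) * essInf b (mu l)) (by
    filter_upwards [ae_essInf_le_of_memLp ha, ae_essInf_le_of_memLp hb] with y h1 h2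
    exact mul_le_mul h1 h2 hbpos.le (hapos.le.trans h1)) q
  have h2 : 0 ≤ k * (inner ℝ v q * inner ℝ v q) := mul_nonneg hk (mul_self_nonneg _)
  simp only [conj_trivial]
  linarith

variable {W k₁ k₂ ε₁ ε₂} in
-- The tip values in the boundary conditions are functionals of the strains. After the tip
-- conditions are absorbed by `bending_iff` and `torsion_iff`, moving the feedback terms to the left
-- turns them into the rank-one parts of stiffness and damping.
lemma balance_iff {X : W.State} (hg : W.g X ∈ W.H2c) (hz : W.z X ∈ W.H1c) (s t : L2 W.l) :
    (X ∈ (W.A k₁ k₂ ε₁ ε₂).domain ∧ wd (wd (W.M X)) = s ∧ wd (W.N X) = t) ↔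
      W.stiffness k₁ k₂ ε₁ ε₂ (WithLp.toLp 2 (wd (wd (W.f X)), wd (W.h X)))
        + W.damping k₁ k₂ (WithLp.toLp 2 (wd (wd (W.g X)), wd (W.z X)))
      = WithLp.toLp 2 (W.J.adjoint (W.J.adjoint s), -W.J.adjoint t) := by
  have hb := bending_iff W.l_pos (W.M X) s
    (k₁ * (val (W.g X) W.l + ε₁ * val (W.f X) W.l))
  have ht := torsion_iff W.l_pos (W.N X) t
    (-(k₂ * (val (W.z X) W.l + ε₂ * val (W.h X) W.l)))
  have hlhs : (X ∈ (W.A k₁ k₂ ε₁ ε₂).domain ∧ wd (wd (W.M X)) = s ∧ wd (W.N X) = t) ↔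
      W.M X = W.J.adjoint (W.J.adjoint s)
        - (k₁ * (val (W.g X) W.l + ε₁ * val (W.f X) W.l)) • W.tip ∧
      W.N X = -(k₂ * (val (W.z X) W.l + ε₂ * val (W.h X) W.l)) • one W.l - W.J.adjoint t := by
    refine Iff.trans ?_ (and_congr hb ht)
    rw [mem_domain_A]
    constructor
    · rintro ⟨⟨⟨-, -, h3, h4, h5⟩, h6, h7⟩, h8, h9⟩
      exact ⟨⟨h3, h5, by linarith, h8⟩, h4, by linarith, h9⟩
    · rintro ⟨⟨h1, h2, h3, h4⟩, h5, h6, h7⟩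
      exact ⟨⟨⟨hg, hz, h1, h5, h2⟩, by linarith, by linarith⟩, h4, h7⟩
  rw [hlhs, ← (WithLp.ofLp_injective 2).eq_iff, Prod.ext_iff, W.val_tip hg, W.val_tip (W.f_mem X),
    W.val_tip' hz, W.val_tip' (W.h_mem X)]
  refine and_congr ?_ ?_
  · change _ ↔ mulL W.EI_mem (wd (wd (W.f X))) + (k₁ * ε₁) • inner ℝ W.tip (wd (wd (W.f X))) • W.tip
      + (mulL W.ηω_mem (mulL W.EI_mem (wd (wd (W.g X))))
        + k₁ • inner ℝ W.tip (wd (wd (W.g X))) • W.tip) = _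
    rw [eq_sub_iff_add_eq, M]
    refine Eq.congr_left ?_
    module
  · change _ ↔ mulL W.GJ_mem (wd (W.h X)) + (k₂ * ε₂) • inner ℝ (one W.l) (wd (W.h X)) • one W.l
      + (mulL W.ηφ_mem (mulL W.GJ_mem (wd (W.z X)))
        + k₂ • inner ℝ (one W.l) (wd (W.z X)) • one W.l) = _
    change _ ↔ _ = -W.J.adjoint t
    rw [N, ← sub_eq_zero, ← sub_eq_zero (b := -_)]
    refine Eq.congr_left ?_
    module

/-- The abstract damped system applies with r = (M''/√ρ, -N'/√Iw): the weights in K cancel those in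
r, and K*r = (J*J*M'', -J*N') is the right side of `balance_iff`. -/
lemma exists_isQuasiMDissipative_A1 (hk₁ : 0 ≤ k₁) (hk₂ : 0 ≤ k₂) :
    ∃ b, IsQuasiMDissipative (conjPMap W.coord (W.A1 k₁ k₂ ε₁ ε₂)) b := by
  have hr : ∀ s, mulL (memLp_sqrt W.ρ_mem) (mulL (memLp_sqrt (memLp_inv W.ρ_mem W.ρ_pos)) s) = s :=
    mulL_mulL_cancel _ _ (ae_sqrt_mul_sqrt_inv W.ρ_mem W.ρ_pos)
  have hI : ∀ s,
      mulL (memLp_sqrt W.Iw_mem) (mulL (memLp_sqrt (memLp_inv W.Iw_mem W.Iw_pos)) s) = s :=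
    mulL_mulL_cancel _ _ (ae_sqrt_mul_sqrt_inv W.Iw_mem W.Iw_pos)
  have hr' : ∀ s, mulL (memLp_sqrt (memLp_inv W.ρ_mem W.ρ_pos)) (mulL (memLp_sqrt W.ρ_mem) s) = s :=
    mulL_mulL_cancel _ _ (by simpa [mul_comm] using ae_sqrt_mul_sqrt_inv W.ρ_mem W.ρ_pos)
  have hI' : ∀ s,
      mulL (memLp_sqrt (memLp_inv W.Iw_mem W.Iw_pos)) (mulL (memLp_sqrt W.Iw_mem) s) = s :=
    mulL_mulL_cancel _ _ (by simpa [mul_comm] using ae_sqrt_mul_sqrt_inv W.Iw_mem W.Iw_pos)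
  have hr2 : ∀ s, mulL (memLp_sqrt W.ρ_mem) (mulL (memLp_inv W.ρ_mem W.ρ_pos) s)
      = mulL (memLp_sqrt (memLp_inv W.ρ_mem W.ρ_pos)) s :=
    mulL_mulL _ _ _ (ae_sqrt_mul_inv W.ρ_mem W.ρ_pos)
  have hI2 : ∀ s, mulL (memLp_sqrt W.Iw_mem) (mulL (memLp_inv W.Iw_mem W.Iw_pos) s)
      = mulL (memLp_sqrt (memLp_inv W.Iw_mem W.Iw_pos)) s :=
    mulL_mulL _ _ _ (ae_sqrt_mul_inv W.Iw_mem W.Iw_pos)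
  have hval : ∀ X : (W.A1 k₁ k₂ ε₁ ε₂).domain, W.coord (W.A1 k₁ k₂ ε₁ ε₂ X) =
      WithLp.toLp 2 (WithLp.toLp 2 (wd (wd (W.g X)), wd (W.z X)),
        -WithLp.toLp 2 (mulL (memLp_sqrt (memLp_inv W.ρ_mem W.ρ_pos)) (wd (wd (W.M X))),
          -mulL (memLp_sqrt (memLp_inv W.Iw_mem W.Iw_pos)) (wd (W.N X)))) := by
    intro X
    rw [← hr2, ← hI2, ← WithLp.toLp_neg, Prod.neg_mk, neg_neg, ← map_neg]
    rfl
  refine exists_isQuasiMDissipative_of_damped W.displacement (W.stiffness k₁ k₂ ε₁ ε₂)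
    (W.damping k₁ k₂)
    (lt_min (mul_pos W.ηω_pos W.EI_pos) (mul_pos W.ηφ_pos W.GJ_pos))
    (le_inner_blockDiag (le_inner_mulC_comp _ _ W.ηω_pos W.EI_pos hk₁ _)
      (le_inner_mulC_comp _ _ W.ηφ_pos W.GJ_pos hk₂ _)) ?_ ?_
  · rintro ⟨x, hx⟩
    obtain ⟨X, rfl⟩ := W.coord.surjective x
    have hX : X ∈ (W.A1 k₁ k₂ ε₁ ε₂).domain := by
      have : W.coord.symm (W.coord X) ∈ (W.A1 k₁ k₂ ε₁ ε₂).domain := hx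
      rwa [W.coord.symm_apply_apply] at this
    have hg : W.g X ∈ W.H2c := hX.2.1
    have hz : W.z X ∈ W.H1c := hX.2.2.1
    refine ⟨WithLp.toLp 2 (wd (wd (W.g X)), wd (W.z X)),
      WithLp.toLp 2 (mulL (memLp_sqrt (memLp_inv W.ρ_mem W.ρ_pos)) (wd (wd (W.M X))),
          -mulL (memLp_sqrt (memLp_inv W.Iw_mem W.Iw_pos)) (wd (W.N X))), ?_, ?_, ?_⟩
    · change WithLp.toLp 2 (mulL (memLp_sqrt W.ρ_mem) (W.g X), mulL (memLp_sqrt W.Iw_mem) (W.z X))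
        = WithLp.toLp 2 (mulL (memLp_sqrt W.ρ_mem) (W.J (W.J (wd (wd (W.g X))))),
          mulL (memLp_sqrt W.Iw_mem) (W.J (wd (W.z X))))
      rw [← eq_J_J hg, ← eq_J hz]
    · refine ((balance_iff hg hz _ _).1 ⟨hX, rfl, rfl⟩).trans ?_
      rw [adjoint_displacement]
      change _ = WithLp.toLp 2 (W.J.adjoint (W.J.adjoint (mulL (memLp_sqrt W.ρ_mem)
        (mulL (memLp_sqrt (memLp_inv W.ρ_mem W.ρ_pos)) (wd (wd (W.M X)))))),
          W.J.adjoint (mulL (memLp_sqrt W.Iw_mem)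
            (-mulL (memLp_sqrt (memLp_inv W.Iw_mem W.Iw_pos)) (wd (W.N X)))))
      rw [hr, map_neg, hI, map_neg]
    · rw [← hval ⟨X, hX⟩]
      change W.coord (W.A1 k₁ k₂ ε₁ ε₂ ⟨W.coord.symm (W.coord X), _⟩) = _
      congr 3
      exact W.coord.symm_apply_apply X
  · intro p q r h
    -- Conversely, these coordinates define a state with velocities g = J²q₁ and z = Jq₂, regular
    -- and clamped at the root; the force balance then puts it in the domain.
    set X := W.coord.symm (WithLp.toLp 2 (p, W.displacement q)) with hX
    have ef : wd (wd (W.f X)) = p.fst := by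
      change wd (wd (W.J (W.J p.fst))) = _
      simp
    have eh : wd (W.h X) = p.snd := by
      change wd (W.J p.snd) = _
      simp
    have eg : W.g X = W.J (W.J q.fst) := hr' _
    have ez : W.z X = W.J q.snd := hI' _
    have eg' : wd (wd (W.g X)) = q.fst := by rw [eg]; simp
    have ez' : wd (W.z X) = q.snd := by rw [ez]; simp
    have hg : W.g X ∈ W.H2c := by rw [eg]; exact W.J_J_mem _
    have hz : W.z X ∈ W.H1c := by rw [ez]; exact W.J_mem _
    obtain ⟨hdom, hM, hN⟩ := (balance_iff (k₁ := k₁) (k₂ := k₂) (ε₁ := ε₁) (ε₂ := ε₂) hg hz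
      (mulL (memLp_sqrt W.ρ_mem) r.fst) (-mulL (memLp_sqrt W.Iw_mem) r.snd)).2 (by
        rw [ef, eh, eg', ez', map_neg, neg_neg, ← adjoint_displacement]
        exact h)
    refine ⟨hdom, (hval ⟨X, hdom⟩).trans ?_⟩
    simp only
    rw [hM, hN, eg', ez', hr', map_neg, hI', neg_neg]
    rfl

/-- The aerodynamic terms `α h + β z + γ g` in coordinates. -/
def aero {α β γ : ℝ → ℝ} (hα : MemLp α ∞ (mu W.l)) (hβ : MemLp β ∞ (mu W.l))
    (hγ : MemLp γ ∞ (mu W.l)) : W.Coord →L[ℝ] L2 W.l :=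
  mulC hα ∘L W.J ∘L WithLp.sndL 2 ℝ (L2 W.l) (L2 W.l) ∘L WithLp.fstL 2 ℝ W.Strain W.Strain
  + mulC hβ ∘L mulC (memLp_sqrt (memLp_inv W.Iw_mem W.Iw_pos)) ∘L
    WithLp.sndL 2 ℝ (L2 W.l) (L2 W.l) ∘L WithLp.sndL 2 ℝ W.Strain W.Strain
  + mulC hγ ∘L mulC (memLp_sqrt (memLp_inv W.ρ_mem W.ρ_pos)) ∘L
    WithLp.fstL 2 ℝ (L2 W.l) (L2 W.l) ∘L WithLp.sndL 2 ℝ W.Strain W.Strain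

/-- The aerodynamic coupling in coordinates. -/
def coupling : W.Coord →L[ℝ] W.Coord :=
  ((WithLp.prodContinuousLinearEquiv 2 ℝ W.Strain W.Strain).symm :
      W.Strain × W.Strain →L[ℝ] W.Coord) ∘L
    ContinuousLinearMap.prod 0
      (((WithLp.prodContinuousLinearEquiv 2 ℝ (L2 W.l) (L2 W.l)).symm :
        L2 W.l × L2 W.l →L[ℝ] W.Strain) ∘L
      ContinuousLinearMap.prod
        (mulC (memLp_sqrt W.ρ_mem) ∘L W.aero W.αω_mem W.βω_mem W.γω_mem)
        (mulC (memLp_sqrt W.Iw_mem) ∘L W.aero W.αφ_mem W.βφ_mem W.γφ_mem))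

/-- No derivatives of the velocities occur and h = Jh', so the coupling is a bounded operator in
coordinates. -/
lemma coord_A2 (x : W.Coord) : W.coord (W.A2 (W.coord.symm x)) = W.coupling x := by
  change WithLp.toLp 2 (WithLp.toLp 2 (wd (wd (0 : L2 W.l)), wd (0 : L2 W.l)), _) = _
  rw [wd_zero, wd_zero]
  rfl

lemma exists_isQuasiMDissipative_A (hk₁ : 0 ≤ k₁) (hk₂ : 0 ≤ k₂) :
    ∃ b, IsQuasiMDissipative (conjPMap W.coord (W.A k₁ k₂ ε₁ ε₂)) b := by
  obtain ⟨b, hb⟩ := W.exists_isQuasiMDissipative_A1 k₁ k₂ ε₁ ε₂ hk₁ hk₂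
  have hdom : (conjPMap W.coord (W.A k₁ k₂ ε₁ ε₂)).domain
      = (conjPMap W.coord (W.A1 k₁ k₂ ε₁ ε₂)).domain := by
    rw [conjPMap_domain, conjPMap_domain, domain_A1]
  refine ⟨_, hb.add W.coupling hdom fun x h' h => ?_⟩
  have hA : W.coord.symm x ∈ (W.A k₁ k₂ ε₁ ε₂).domain := h'
  have hA1 : W.coord.symm x ∈ (W.A1 k₁ k₂ ε₁ ε₂).domain := h
  rw [conjPMap_apply _ _ hA, conjPMap_apply _ _ hA1, W.A_apply hA hA1, map_add, coord_A2]

end Wing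

end FlexibleWing

end

/-! ### The generation theorem. -/

theorem theorem2 (W : FlexibleWing.Wing) (k₁ k₂ ε₁ ε₂ : ℝ) (hk₁ : 0 ≤ k₁) (hk₂ : 0 ≤ k₂)
    (hε₁ : 0 < ε₁) (hε₁' : ε₁ < min W.ε₁star (1 / W.Km))
    (hε₂ : 0 < ε₂) (hε₂' : ε₂ < min W.ε₂star (1 / W.Km)) :
    W.A k₁ k₂ ε₁ ε₂ = W.A1 k₁ k₂ ε₁ ε₂ + W.A2.toPMap ⊤ ∧
    ∃ c : InnerProductSpace.Core ℝ W.State,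
      (∀ X Y : W.State, c.inner X Y = W.inner2 ε₁ ε₂ X Y) ∧
      FlexibleWing.IsHilbert c ∧
      FlexibleWing.GeneratesC0Semigroup c (W.A k₁ k₂ ε₁ ε₂) := by
  have h1 : ε₁ < 1 / W.Km := hε₁'.trans_le (min_le_right _ _)
  have h2 : ε₂ < 1 / W.Km := hε₂'.trans_le (min_le_right _ _)
  obtain ⟨m, C, hm, hC, hlow, hup⟩ := W.exists_equivalent hε₁.le h1 hε₂.le h2
  obtain ⟨b, hb⟩ := W.exists_isQuasiMDissipative_A k₁ k₂ ε₁ ε₂ hk₁ hk₂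
  obtain ⟨hH, hG⟩ := FlexibleWing.isHilbert_and_generates_of_equivalent
    (W.core hε₁.le h1 hε₂.le h2) W.coord hm hC hlow hup
  exact ⟨W.A_eq k₁ k₂ ε₁ ε₂, W.core hε₁.le h1 hε₂.le h2, fun _ _ => rfl, hH, hG _ b hb⟩
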